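/- Let $X$ be one of the classical affine types $A_{2l-1}^{(2)}$ ($l\ge 3$), $A_{2l}^{(2)}$ ($l\ge 1$; $\alpha_0$ is the shortest simple root), $B_l^{(1)}$ ($l\ge 3$), $C_l^{(1)}$ ($l\ge 2$), $D_l^{(1)}$ ($l\ge 4$), $D_{l+1}^{(2)}$ ($l\ge 2$), with Dynkin vertices $0,1,\dots,l$. Let $W=\langle\sigma_0,\dots,\sigma_l\rangle\subset GL(\mathfrak h^*)$ be its affine Weyl group with length function $\ell$, and let $W^0=\{w\in W\mid \ell(w\sigma_i)>\ell(w)\text{ for all } i\neq 0\}$ be the affine Grassmannian. **Abaci.** An abacus of charge $0$ of type $X$ is identified with its set $B$ of bead positions: $B\subset\mathbb Z$ for $X=C_l^{(1)}$ and $B\subset\mathbb Z_{\ge 0}$ otherwise. The abacus $\varnothing_X$ of $\Lambda_0$ is $\mathbb Z_{<0}$ for $C_l^{(1)}$ and $\emptyset$ otherwise. Let $e_X=2l$ for $A_{2l-1}^{(2)},C_l^{(1)},D_l^{(1)}$, $e_X=2l+1$ for $A_{2l}^{(2)},B_l^{(1)}$, and $e_X=2l+2$ for $D_{l+1}^{(2)}$;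 let $m_X=2l+1$ for $B_l^{(1)},D_{l+1}^{(2)}$ and $m_X=2l$ otherwise. For $k\in\mathbb Z$ and $1\le a\le l$ write $(a)_k=ke_X+a-1$ and $(-a)_k=ke_X+m_X-a$. For every $k\in\mathbb Z$ the following bead moves (from an occupied to an empty position, both being positions of the abacus) are the $f_i$-moves: * $0<i<l$: $(i)_k\to(i+1)_k$ and $(-i-1)_k\to(-i)_k$; * $i=0$: $(-1)_{k-1}\to(1)_k$ for $A_{2l}^{(2)},C_l^{(1)},D_{l+1}^{(2)}$; $(-1)_{k-1}\to(2)_k$ and $(-2)_{k-1}\to(1)_k$ for $A_{2l-1}^{(2)},B_l^{(1)},D_l^{(1)}$; * $i=l$: $(l)_k\to(-l)_k$ if $X\ne D_l^{(1)}$; $(l)_k\to(1-l)_k$ and $(l-1)_k\to(-l)_k$ for $D_l^{(1)}$; * in addition, $f_0$ places a bead at the empty position $0$ for $A_{2l}^{(2)},D_{l+1}^{(2)}$, and beads at the positions $0,1$, if both are empty, for $A_{2l-1}^{(2)},B_l^{(1)},D_l^{(1)}$. The generator $\sigma_i$ acts on abaci by doing all possible $f_i$-moves and undoing all those that can be undone.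 A *$0$-core* of type $X$ is an abacus obtained from $\varnothing_X$ by applying finitely many $\sigma_i$. **Partitions.** The $\beta$-set of a partition $\lambda$ is $\beta_0(\lambda)=\{\lambda_i-i\mid i\ge 1\}$. A $0$-core of type $A_{e-1}^{(1)}$ is an $e$-core, i.e. a partition $\lambda$ such that $x\in\beta_0(\lambda)$ implies $x-e\in\beta_0(\lambda)$. A partition is even if its Young diagram has an even number of diagonal nodes. The partition $\ddot\lambda$ of an abacus $B$ is the one with $\beta$-set $B$ for $C_l^{(1)}$; $B\cup\{y<0\mid -1-y\notin B\}$ for $A_{2l-1}^{(2)},B_l^{(1)},D_l^{(1)}$; and $B\cup\{y<0\mid -2-y\notin B\}$ for $A_{2l}^{(2)},D_{l+1}^{(2)}$. Call a partition doubled distinct if its Frobenius notation is $(\nu_1-1,\dots,\nu_m-1\mid\nu_1,\dots,\nu_m)$. **Proposition.** 1. An abacus of charge $0$ with partition $\ddot\lambda$ is a $0$-core of type $X$ if and only if $\ddot\lambda$ is * a self-conjugate $2l$-core, for $C_l^{(1)}$; * an even self-conjugate $2l$-core, for $D_l^{(1)}$ and $A_{2l-1}^{(2)}$; * an even self-conjugate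 $(2l+1)$-core, for $B_l^{(1)}$; * a doubled distinct $(2l+1)$-core, for $A_{2l}^{(2)}$; * a doubled distinct $(2l+2)$-core, for $D_{l+1}^{(2)}$. 2. There is an action of $W$ on the set of $0$-cores of type $X$ in which each $\sigma_i$ acts as above, and $w\mapsto w(\varnothing_X)$ is a bijection from $W^0$ onto the set of $0$-cores of type $X$. Sending $w$ to the partition $\ddot\lambda$ of $w(\varnothing_X)$ is a bijection from $W^0$ onto the set of all partitions described in 1. 3. Consequently $W^0$ is parameterized by self-conjugate $0$-cores of type $A_{2l-1}^{(1)}$ or $A_{2l}^{(1)}$: by the bijection of 2 for $A_{2l-1}^{(2)},B_l^{(1)},C_l^{(1)},D_l^{(1)}$; and for $A_{2l}^{(2)}$ and $D_{l+1}^{(2)}$ there is a bijection from $W^0$ onto the set of all self-conjugate $2l$-cores, sending $w$ to the partition with $\beta$-set $B'\cup\{y<0\mid -1-y\notin B'\}$, where $B'$ arises from $w(\varnothing_X)$ by moving each bead at $(a)_k$ to $2lk+a-1$ and each bead at $(-a)_k$ to $2lk+2l-a$ (deleting the other runners). -/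

import Mathlib

/-- The classical affine types of rank `l` other than `A_l^{(1)}`. -/
inductive ClassicalAffineType where
  /-- `A_{2l-1}^{(2)}` -/
  | A2odd
  /-- `A_{2l}^{(2)}`, with `α_0` the shortest simple root -/
  | A2even
  /-- `B_l^{(1)}` -/
  | B1
  /-- `C_l^{(1)}` -/
  | C1
  /-- `D_l^{(1)}` -/
  | D1
  /-- `D_{l+1}^{(2)}` -/
  | D2

namespace ClassicalAffineType

/-- The smallest rank `l` for which the type occurs in the classification. -/
def minRank : ClassicalAffineType → ℕ
  | A2odd => 3
  | A2even => 1
  | B1 => 3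
  | C1 => 2
  | D1 => 4
  | D2 => 2

/-- The Dynkin diagram branches at the vertices `0, 1, 2`. -/
def LeftFork : ClassicalAffineType → Bool
  | A2odd => true
  | B1 => true
  | D1 => true
  | _ => false

/-- `α_0` is shorter than `α_1` (and `0` is not a branch vertex), that is, `0 ⇐ 1`. -/
def LeftShort : ClassicalAffineType → Bool
  | A2even => true
  | D2 => true
  | _ => false

/-- `α_l` is shorter than `α_{l-1}`, that is, `l-1 ⇒ l`. -/
def RightShort : ClassicalAffineType → Bool
  | B1 => true
  | D2 => true
  | _ => false

/-! ### Cartan matrices and affine Weyl groups -/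

/-- The pair `(a_{ij}, a_{ji})` of entries of the Cartan matrix, for `i < j`. -/
def cartanPair (l i j : ℕ) : ClassicalAffineType → ℤ × ℤ
  | C1 =>
      if j ≠ i + 1 then (0, 0) else if i = 0 then (-1, -2)
      else if j = l then (-2, -1) else (-1, -1)
  | A2even =>
      if j ≠ i + 1 then (0, 0) else if l = 1 then (-4, -1)
      else if i = 0 then (-2, -1) else if j = l then (-2, -1) else (-1, -1)
  | D2 =>
      if j ≠ i + 1 then (0, 0) else if i = 0 then (-2, -1)
      else if j = l then (-1, -2) else (-1, -1)
  | A2odd =>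
      if i = 0 then (if j = 2 then (-1, -1) else (0, 0))
      else if j ≠ i + 1 then (0, 0) else if j = l then (-2, -1) else (-1, -1)
  | B1 =>
      if i = 0 then (if j = 2 then (-1, -1) else (0, 0))
      else if j ≠ i + 1 then (0, 0) else if j = l then (-1, -2) else (-1, -1)
  | D1 =>
      if i = 0 then (if j = 2 then (-1, -1) else (0, 0))
      else if j = l then (if i + 2 = l then (-1, -1) else (0, 0))
      else if j = i + 1 then (-1, -1) else (0, 0)

/-- The Cartan matrix, `a_{ij} = ⟨α_i^∨, α_j⟩`, with rows and columns labelled `0, …, l`. -/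
def cartan (X : ClassicalAffineType) (l : ℕ) : Matrix (Fin (l + 1)) (Fin (l + 1)) ℤ :=
  fun i j =>
    if i = j then 2
    else if i < j then (cartanPair l i j X).1 else (cartanPair l j i X).2

/-- The space `𝔥^*` of a realization of the Cartan matrix: it has dimension `l + 2`, and the
first component of `v` lists the numbers `⟨v, α_i^∨⟩`. -/
abbrev DualCartan (l : ℕ) : Type := (Fin (l + 1) → ℂ) × ℂ

/-- The simple root `α_j`; the last coordinate, `1` for `α_0` and `0` for the others, makes
the simple roots linearly independent. -/
def simpleRoot (X : ClassicalAffineType) (l : ℕ) (j : Fin (l + 1)) : DualCartan l :=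
  (fun i => (cartan X l i j : ℂ), if j = 0 then 1 else 0)

/-- The simple coroot `α_i^∨`, as a linear form on `𝔥^*`. -/
def simpleCoroot (l : ℕ) (i : Fin (l + 1)) : Module.Dual ℂ (DualCartan l) :=
  (LinearMap.proj i).comp (LinearMap.fst ℂ (Fin (l + 1) → ℂ) ℂ)

theorem simpleCoroot_simpleRoot (X : ClassicalAffineType) (l : ℕ) (i : Fin (l + 1)) :
    simpleCoroot l i (simpleRoot X l i) = 2 := by
  simp [simpleCoroot, simpleRoot, cartan]

/-- The fundamental reflection `σ_i(v) = v - ⟨v, α_i^∨⟩ α_i`. -/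
noncomputable def reflection (X : ClassicalAffineType) (l : ℕ) (i : Fin (l + 1)) :
    DualCartan l ≃ₗ[ℂ] DualCartan l :=
  Module.reflection (simpleCoroot_simpleRoot X l i)

/-- The affine Weyl group `W`, the subgroup of `GL(𝔥^*)` generated by the fundamental
reflections. -/
noncomputable def weylGroup (X : ClassicalAffineType) (l : ℕ) :
    Subgroup (DualCartan l ≃ₗ[ℂ] DualCartan l) :=
  Subgroup.closure (Set.range (reflection X l))

/-- The fundamental reflection `σ_i` as an element of `W`. -/
noncomputable def gen (X : ClassicalAffineType) (l : ℕ) (i : Fin (l + 1)) : weylGroup X l :=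
  ⟨reflection X l i, Subgroup.subset_closure (Set.mem_range_self i)⟩

/-- The length of `w ∈ W`: the least length of an expression as a product of `σ_i`'s. -/
noncomputable def length (X : ClassicalAffineType) (l : ℕ) (w : weylGroup X l) : ℕ :=
  sInf {n | ∃ ws : List (Fin (l + 1)), ws.length = n ∧ (ws.map (gen X l)).prod = w}

/-- The affine Grassmannian `W^0`: the `w ∈ W` with `ℓ(wσ_i) > ℓ(w)` for all `i ≠ 0`. -/
def grassmannian (X : ClassicalAffineType) (l : ℕ) : Set (weylGroup X l) :=
  {w | ∀ i : Fin (l + 1), i ≠ 0 → length X l w < length X l (w * gen X l i)}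

/-! ### Abaci of charge zero and the action of the Weyl group

An abacus is identified with the set of the positions of its beads. -/

/-- The number `|I_X|` of indices: `I_X` consists of `±1, …, ±l`, of `0` if `0 ⇐ 1`, and of
`l + 1` if `l-1 ⇒ l`. -/
def numRunners (X : ClassicalAffineType) (l : ℕ) : ℕ :=
  2 * l + (if LeftShort X then 1 else 0) + (if RightShort X then 1 else 0)

/-- The position whose `l`-index is `(2k, a)`, for `1 ≤ a ≤ l`. -/
def posPlus (X : ClassicalAffineType) (l : ℕ) (k a : ℤ) : ℤ :=
  k * numRunners X l + (a - 1)

/-- The position whose `l`-index is `(2k + 1, -a)`, for `1 ≤ a ≤ l`. -/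
def posMinus (X : ClassicalAffineType) (l : ℕ) (k a : ℤ) : ℤ :=
  k * numRunners X l + (2 * l + (if RightShort X then 1 else 0) - a)

/-- An `f_i`-action (or `2f_i`-action) may move a bead from position `x` to position `y`. -/
def FMove (X : ClassicalAffineType) (l : ℕ) (i : ℕ) (x y : ℤ) : Prop :=
  (0 < i ∧ i < l ∧ ∃ k : ℤ,
    (x = posPlus X l k i ∧ y = posPlus X l k (i + 1)) ∨
    (x = posMinus X l k (i + 1) ∧ y = posMinus X l k i)) ∨
  (i = 0 ∧ ∃ k : ℤ, match X with
    | C1 | A2even | D2 => x = posMinus X l (k - 1) 1 ∧ y = posPlus X l k 1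
    | A2odd | B1 | D1 =>
      (x = posMinus X l (k - 1) 1 ∧ y = posPlus X l k 2) ∨
      (x = posMinus X l (k - 1) 2 ∧ y = posPlus X l k 1)) ∨
  (i = l ∧ ∃ k : ℤ, match X with
    | A2odd | A2even | B1 | C1 | D2 => x = posPlus X l k l ∧ y = posMinus X l k l
    | D1 =>
      (x = posPlus X l k l ∧ y = posMinus X l k (l - 1)) ∨
      (x = posPlus X l k (l - 1) ∧ y = posMinus X l k l))

/-- The positions of the abaci of charge `0`: whole abaci in type `C_l^{(1)}`, half abaci
with positions `≥ 0` in the other types. -/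
def positions : ClassicalAffineType → Set ℤ
  | C1 => Set.univ
  | _ => Set.Ici 0

/-- The positions that a special `f_0`-action on a half abacus fills simultaneously. -/
def bornPositions : ClassicalAffineType → Set ℤ
  | C1 => ∅
  | A2even | D2 => {0}
  | A2odd | B1 | D1 => {0, 1}

/-- The abacus of the fundamental weight `Λ_0`. -/
def emptyAbacus : ClassicalAffineType → Set ℤ
  | C1 => Set.Iio 0
  | _ => ∅

/-- Positions `x` and `y` are joined by a bead move of `f_i`, in one of the two directions. -/
def Linked (X : ClassicalAffineType) (l : ℕ) (i : ℕ) (x y : ℤ) : Prop :=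
  x ∈ positions X ∧ y ∈ positions X ∧ (FMove X l i x y ∨ FMove X l i y x)

open Classical in
/-- The action of `σ_i` on abaci: all possible `f_i`-actions are done, and all possible
`f_i`-actions are undone. A bead move exchanges the contents of the two positions; a special
`f_0`-action fills the empty positions `bornPositions X`, and is undone by emptying them. -/
noncomputable def sigma (X : ClassicalAffineType) (l : ℕ) (i : ℕ) (B : Set ℤ) : Set ℤ :=
  let C : Set ℤ := {y | (∃ x ∈ B, Linked X l i x y) ∨ (y ∈ B ∧ ¬ ∃ x, Linked X l i x y)}
  if i = 0 then
    if Disjoint (bornPositions X) B then C ∪ bornPositions X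
    else if bornPositions X ⊆ B then C \ bornPositions X
    else C
  else C

/-- The `0`-core abaci: the abaci in the orbit of the abacus of `Λ_0` under the action of
the affine Weyl group, that is, under all products of the `σ_i`. -/
def coreAbaci (X : ClassicalAffineType) (l : ℕ) : Set (Set ℤ) :=
  {B | ∃ ws : List (Fin (l + 1)),
    B = ws.foldr (fun i B' => sigma X l i B') (emptyAbacus X)}

/-- The abacus of `Λ_0` as a `0`-core abacus. -/
def emptyCore (X : ClassicalAffineType) (l : ℕ) : coreAbaci X l :=
  ⟨emptyAbacus X, [], rfl⟩

/-! ### Partitions -/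

/-- The `β`-set of charge `0` of a partition, `{λ_i - i | i ≥ 1}`. -/
def betaSet (μ : YoungDiagram) : Set ℤ :=
  {x | ∃ i : ℕ, x = (μ.rowLen i : ℤ) - (i + 1)}

/-- `μ` is a `0`-core of type `A_{e-1}^{(1)}` (an `e`-core): in its abacus no bead at a
position `x` can be moved to an empty position `x - e`. -/
def IsACore (e : ℕ) (μ : YoungDiagram) : Prop :=
  ∀ x ∈ betaSet μ, x - e ∈ betaSet μ

/-- `μ` is self-conjugate. -/
def IsSelfConjugate (μ : YoungDiagram) : Prop :=
  μ.transpose = μ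

/-- `μ` is even: the number of diagonal nodes of its Young diagram is even. -/
def IsEvenDiagram (μ : YoungDiagram) : Prop :=
  Even (μ.cells.filter (fun c => c.1 = c.2)).card

/-- `μ` is the double of a partition with distinct parts: at every diagonal node the leg is
longer than the arm by one, i.e. `μ = (ν_1 - 1, …, ν_m - 1 | ν_1, …, ν_m)` in Frobenius
notation, with `ν_1 > ⋯ > ν_m ≥ 1`. -/
def IsDoubledDistinct (μ : YoungDiagram) : Prop :=
  ∀ i : ℕ, (i, i) ∈ μ → μ.colLen i = μ.rowLen i + 1

/-- The double of a half abacus about `-1/2`. -/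
def selfConjugateDouble (B : Set ℤ) : Set ℤ :=
  B ∪ {y | y < 0 ∧ -1 - y ∉ B}

/-- The two-sided `β`-set associated with a charge `0` abacus: a whole abacus is its own
associated set; a half abacus is doubled about `-1/2`, or about `-1` if `0 ⇐ 1`. The
partition with this `β`-set is the doubled partition of the abacus. -/
def associated (X : ClassicalAffineType) (B : Set ℤ) : Set ℤ :=
  match X with
  | C1 => B
  | A2odd | B1 | D1 => selfConjugateDouble B
  | A2even | D2 => B ∪ {y | y < 0 ∧ -2 - y ∉ B}

/-- The partitions that occur as doubled partitions of `0`-core abaci. -/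
def IsCorePartition (X : ClassicalAffineType) (l : ℕ) (μ : YoungDiagram) : Prop :=
  match X with
  | C1 => IsSelfConjugate μ ∧ IsACore (2 * l) μ
  | D1 | A2odd => IsSelfConjugate μ ∧ IsEvenDiagram μ ∧ IsACore (2 * l) μ
  | B1 => IsSelfConjugate μ ∧ IsEvenDiagram μ ∧ IsACore (2 * l + 1) μ
  | A2even => IsDoubledDistinct μ ∧ IsACore (2 * l + 1) μ
  | D2 => IsDoubledDistinct μ ∧ IsACore (2 * l + 2) μ

/-- Delete the positions with index `0` or `l + 1` and renumber the remaining ones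
consecutively, keeping their `l`-indices; the result has `2l` runners. -/
def deleteRunners (X : ClassicalAffineType) (l : ℕ) (B : Set ℤ) : Set ℤ :=
  {y | ∃ k a : ℤ, 1 ≤ a ∧ a ≤ l ∧
    ((posPlus X l k a ∈ B ∧ y = 2 * l * k + (a - 1)) ∨
     (posMinus X l k a ∈ B ∧ y = 2 * l * k + (2 * l - a)))}

/-- The `β`-set of the self-conjugate partition attached to a charge `0` abacus. For the types
whose doubled partitions are not self-conjugate, the runners `0` and `l + 1` are deleted and
the resulting half abacus is doubled about `-1/2`. -/
def selfConjugateBeta (X : ClassicalAffineType) (l : ℕ) (B : Set ℤ) : Set ℤ :=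
  match X with
  | A2even | D2 => selfConjugateDouble (deleteRunners X l B)
  | C1 | A2odd | B1 | D1 => associated X B

/-- The self-conjugate cores that parameterize the affine Grassmannian. -/
def IsSelfConjugateCore (X : ClassicalAffineType) (l : ℕ) (μ : YoungDiagram) : Prop :=
  match X with
  | C1 | A2even | D2 => IsSelfConjugate μ ∧ IsACore (2 * l) μ
  | D1 | A2odd => IsSelfConjugate μ ∧ IsEvenDiagram μ ∧ IsACore (2 * l) μ
  | B1 => IsSelfConjugate μ ∧ IsEvenDiagram μ ∧ IsACore (2 * l + 1) μ

end ClassicalAffineType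

/-! Everything is coordinatized by charges. On an abacus of a core, each runner is filled up to a
certain block, and duality gives the runners labelled `a` and `-a` opposite charges, while the
runners labelled `0` and `l + 1` have charge zero. Thus a vector `c` of `l` integers describes a
core: its doubled abacus is `fullAbacus`, and the abacus itself is the part lying in `positions`.
Conversely, the full abaci are exactly the β-sets that are `e`-cores and are dual to themselves
about the relevant centre (`exists_eq_fullAbacus`), where duality about `-1/2` means self-conjugate
and duality about `-1` means doubled distinct. The number of diagonal nodes is the sum of the `|c
j|`, so evenness is the condition that the sum of the charges is even.

On charges, `σ_i` is the reflection in a wall of an alcove (`sigma_abacus`): it interchanges or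
negates coordinates, and for `i = 0` also translates. The orbit of `c = 0` consists of all integral
vectors, or of those with even sum if the diagram branches at `0, 1, 2`. To see this, reflect in
walls that separate `c` from an interior point of the alcove. The distance to that point decreases,
and the only admissible vector in the closed alcove is `0` (`energy_chargeRefl_lt`,
`eq_zero_of_kappa_nonneg`).

The bridge to the Weyl group is `weight`, an injective map from charges to `𝔥^*` that intertwines
`σ_i` with the fundamental reflection and sends `0` to `Λ_0`. Hence the cores are a copy of the
orbit `WΛ_0`, and the action of `W` on them is transported from `𝔥^*`, so no relations of `W` need
to be verified on abaci.

Finally, `W^0` parameterizes the orbit. Surjectivity comes from taking an element of least length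
that sends `∅_X` to a given core. Injectivity (`grassmannian_eq_of_apply_eq`) rests on the fact that
`wα_i` is a nonnegative combination of simple roots whenever `ℓ(wσ_i) > ℓ(w)`
(`apply_simpleRoot_mem_posCone`). This is proved by the classical reduction to rank two. -/

namespace ClassicalAffineType

variable {X : ClassicalAffineType} {l : ℕ}

/-! ### Words and lengths in the affine Weyl group -/

theorem gen_apply (i : Fin (l + 1)) (v : DualCartan l) :
    (gen X l i).1 v = v - v.1 i • simpleRoot X l i :=
  Module.reflection_apply v (simpleCoroot_simpleRoot X l i)

theorem weyl_mul_apply (w w' : weylGroup X l) (v : DualCartan l) :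
    (w * w').1 v = w.1 (w'.1 v) := rfl

theorem gen_mul_self (i : Fin (l + 1)) : gen X l i * gen X l i = 1 := by
  refine Subtype.ext (LinearEquiv.ext fun v => ?_)
  exact Module.involutive_reflection (simpleCoroot_simpleRoot X l i) v

theorem mul_gen_mul_gen (w : weylGroup X l) (i : Fin (l + 1)) :
    w * gen X l i * gen X l i = w := by
  rw [mul_assoc, gen_mul_self, mul_one]

theorem gen_inv (i : Fin (l + 1)) : (gen X l i)⁻¹ = gen X l i :=
  inv_eq_of_mul_eq_one_left (gen_mul_self i)

theorem exists_word (w : weylGroup X l) :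
    ∃ ws : List (Fin (l + 1)), (ws.map (gen X l)).prod = w := by
  obtain ⟨g, hg⟩ := w
  induction hg using Subgroup.closure_induction with
  | mem x hx =>
    obtain ⟨i, rfl⟩ := hx
    exact ⟨[i], by simp [gen]⟩
  | one => exact ⟨[], rfl⟩
  | mul x y hx hy ihx ihy =>
    obtain ⟨u, hu⟩ := ihx
    obtain ⟨v, hv⟩ := ihy
    exact ⟨u ++ v, by rw [List.map_append, List.prod_append, hu, hv]; rfl⟩
  | inv x hx ih =>
    obtain ⟨u, hu⟩ := ih
    refine ⟨u.reverse, ?_⟩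
    have h2 : (⟨x⁻¹, inv_mem hx⟩ : weylGroup X l) = (⟨x, hx⟩ : weylGroup X l)⁻¹ := rfl
    have h3 : (fun x => x⁻¹) ∘ gen X l = gen X l := funext fun i => gen_inv i
    rw [h2, ← hu, List.prod_inv_reverse, List.map_map, List.map_reverse, h3]

theorem length_le (ws : List (Fin (l + 1))) :
    length X l (ws.map (gen X l)).prod ≤ ws.length :=
  Nat.sInf_le ⟨ws, rfl, rfl⟩

theorem exists_reduced_word (w : weylGroup X l) :
    ∃ ws : List (Fin (l + 1)), ws.length = length X l w ∧ (ws.map (gen X l)).prod = w := by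
  obtain ⟨ws, h⟩ := exists_word w
  exact Nat.sInf_mem
    (s := {n | ∃ ws : List (Fin (l + 1)), ws.length = n ∧ (ws.map (gen X l)).prod = w})
    ⟨_, ws, rfl, h⟩

theorem length_mul_gen_le (w : weylGroup X l) (i : Fin (l + 1)) :
    length X l (w * gen X l i) ≤ length X l w + 1 := by
  obtain ⟨ws, h1, h2⟩ := exists_reduced_word w
  have := length_le (X := X) (ws ++ [i])
  simpa [h1, h2] using this

theorem det_gen (i : Fin (l + 1)) :
    LinearMap.det ((gen X l i).1 : DualCartan l →ₗ[ℂ] DualCartan l) = -1 := by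
  have h : ((gen X l i).1 : DualCartan l →ₗ[ℂ] DualCartan l) =
      LinearMap.transvection (simpleCoroot l i) (-simpleRoot X l i) := by
    refine LinearMap.ext fun v => ?_
    simp only [LinearEquiv.coe_coe, gen_apply, LinearMap.transvection.apply, smul_neg]
    exact sub_eq_add_neg _ _
  rw [h, LinearMap.transvection.det, map_neg, simpleCoroot_simpleRoot]
  norm_num

theorem det_eq_neg_one_pow (ws : List (Fin (l + 1))) :
    LinearMap.det ((ws.map (gen X l)).prod.1 : DualCartan l →ₗ[ℂ] DualCartan l) =
      (-1) ^ ws.length := by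
  induction ws with
  | nil => exact LinearMap.det_id
  | cons i ws ih =>
    have h : (((i :: ws).map (gen X l)).prod.1 : DualCartan l →ₗ[ℂ] DualCartan l) =
      ((gen X l i).1 : DualCartan l →ₗ[ℂ] DualCartan l).comp
        ((ws.map (gen X l)).prod.1 : DualCartan l →ₗ[ℂ] DualCartan l) := rfl
    rw [h, LinearMap.det_comp, det_gen, ih, List.length_cons, pow_succ']

/-- The determinant of `w` is the sign of the parity of the length of any word for `w`, and a
reflection has determinant `-1`. -/
theorem length_mul_gen_ne (w : weylGroup X l) (i : Fin (l + 1)) :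
    length X l (w * gen X l i) ≠ length X l w := by
  intro h
  obtain ⟨u, hu1, hu2⟩ := exists_reduced_word w
  obtain ⟨v, hv1, hv2⟩ := exists_reduced_word (w * gen X l i)
  have h1 := det_eq_neg_one_pow (X := X) (u ++ [i])
  have h2 := det_eq_neg_one_pow (X := X) v
  rw [List.map_append, List.prod_append, hu2, List.map_singleton, List.prod_singleton,
    List.length_append, hu1, List.length_singleton] at h1
  rw [hv2, h1, hv1, h, pow_succ] at h2
  have h3 : ((-1 : ℂ) ^ length X l w) ≠ 0 := pow_ne_zero _ (by norm_num)
  have h4 : (-1 : ℂ) = 1 := mul_left_cancel₀ h3 (by rw [h2, mul_one])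
  norm_num at h4

theorem length_mul_gen (w : weylGroup X l) (i : Fin (l + 1)) :
    length X l (w * gen X l i) = length X l w + 1 ∨
      length X l w = length X l (w * gen X l i) + 1 := by
  have h1 := length_mul_gen_le w i
  have h2 := length_mul_gen_le (w * gen X l i) i
  rw [mul_gen_mul_gen] at h2
  have h3 := length_mul_gen_ne w i
  omega

theorem exists_length_mul_gen_lt {w : weylGroup X l} (h : w ≠ 1) :
    ∃ i, length X l (w * gen X l i) < length X l w := by
  obtain ⟨ws, h1, h2⟩ := exists_reduced_word w
  rcases List.eq_nil_or_concat ws with rfl | ⟨u, i, rfl⟩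
  · exact absurd h2.symm h
  · refine ⟨i, ?_⟩
    have h3 : w * gen X l i = (u.map (gen X l)).prod := by
      rw [← h2, List.concat_eq_append, List.map_append, List.prod_append, List.map_singleton,
        List.prod_singleton, mul_gen_mul_gen]
    rw [h3, ← h1]
    have := length_le (X := X) u
    simp only [List.concat_eq_append, List.length_append, List.length_singleton]
    omega

/-! ### Positivity of roots -/

/-- The alternating product of `k` factors `s`, `t`, the last of which is `t`. -/
def altProd {G : Type*} [Group G] (s t : G) : ℕ → G
  | 0 => 1
  | k + 1 => altProd t s k * t

theorem length_mul_altProd_le (w : weylGroup X l) (i j : Fin (l + 1)) (k : ℕ) :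
    length X l (w * altProd (gen X l i) (gen X l j) k) ≤ length X l w + k := by
  induction k generalizing i j with
  | zero => simp [altProd]
  | succ k ih =>
    rw [altProd, ← mul_assoc]
    have := length_mul_gen_le (w * altProd (gen X l j) (gen X l i) k) j
    have := ih j i
    omega

/-- This picks the shortest element `v` of the coset of `w` modulo the subgroup generated by `σ_i`
and `σ_j`. As long as there is a descent among the two, strip it off on the right. The descents
alternate, since a stripped generator has become an ascent. -/
theorem exists_eq_mul_altProd (i j : Fin (l + 1)) (w : weylGroup X l)
    (h : length X l w < length X l (w * gen X l i)) :
    ∃ (v : weylGroup X l) (k : ℕ), w = v * altProd (gen X l i) (gen X l j) k ∧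
      length X l w = length X l v + k ∧ length X l v < length X l (v * gen X l i) ∧
      length X l v < length X l (v * gen X l j) := by
  induction hn : length X l w generalizing w i j with
  | zero =>
    refine ⟨w, 0, by simp [altProd], by simp [hn], h, ?_⟩
    have := length_mul_gen w j
    omega
  | succ n ih =>
    rcases length_mul_gen w j with hj | hj
    · exact ⟨w, 0, by simp [altProd], by simp [hn], h, by omega⟩
    · obtain ⟨v, k, h1, h2, h3, h4⟩ := ih j i (w * gen X l j)
        (by rw [mul_gen_mul_gen]; omega) (by omega)
      refine ⟨v, k + 1, ?_, by omega, h4, h3⟩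
      rw [altProd, ← mul_assoc, ← h1, mul_gen_mul_gen]

/-- The cone of nonnegative integral combinations of simple roots. -/
def posCone (X : ClassicalAffineType) (l : ℕ) : AddSubmonoid (DualCartan l) :=
  AddSubmonoid.closure (Set.range (simpleRoot X l))

theorem simpleRoot_mem_posCone (i : Fin (l + 1)) : simpleRoot X l i ∈ posCone X l :=
  AddSubmonoid.subset_closure (Set.mem_range_self i)

/-! ### Rank two: the roots spanned by two simple roots -/

theorem cartan_self (i : Fin (l + 1)) : cartan X l i i = 2 := by simp [cartan]

theorem cartan_rank_two {i j : Fin (l + 1)} (h : i ≠ j) :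
    (cartan X l i j = 0 ∧ cartan X l j i = 0) ∨ (cartan X l i j = -1 ∧ cartan X l j i = -1) ∨
    (cartan X l i j = -1 ∧ cartan X l j i = -2) ∨ (cartan X l i j = -2 ∧ cartan X l j i = -1) ∨
    (cartan X l i j = -4 ∧ cartan X l j i = -1) ∨ (cartan X l i j = -1 ∧ cartan X l j i = -4) := by
  have key : ∀ a b : ℕ, (cartanPair l a b X).1 = 0 ∧ (cartanPair l a b X).2 = 0 ∨
      (cartanPair l a b X).1 = -1 ∧ (cartanPair l a b X).2 = -1 ∨
      (cartanPair l a b X).1 = -1 ∧ (cartanPair l a b X).2 = -2 ∨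
      (cartanPair l a b X).1 = -2 ∧ (cartanPair l a b X).2 = -1 ∨
      (cartanPair l a b X).1 = -4 ∧ (cartanPair l a b X).2 = -1 := by
    intro a b
    cases X <;> simp only [cartanPair] <;> split_ifs <;> simp
  rcases lt_or_gt_of_ne h with hij | hij
  · have := key i j
    simp only [cartan, h, h.symm, hij, hij.not_gt, if_true, if_false]
    omega
  · have := key j i
    simp only [cartan, h, h.symm, hij, hij.not_gt, if_true, if_false]
    omega

theorem simpleRoot_fst (i j : Fin (l + 1)) : (simpleRoot X l j).1 i = (cartan X l i j : ℂ) := rfl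

theorem gen_apply_simpleRoot (i j : Fin (l + 1)) :
    (gen X l i).1 (simpleRoot X l j) =
      simpleRoot X l j - (cartan X l i j : ℂ) • simpleRoot X l i := gen_apply i _

theorem gen_apply_simpleRoot_self (i : Fin (l + 1)) :
    (gen X l i).1 (simpleRoot X l i) = -simpleRoot X l i := by
  rw [gen_apply_simpleRoot, cartan_self]
  module

theorem altProd_mul_apply (i j : Fin (l + 1)) (k : ℕ) (v : DualCartan l) :
    (altProd (gen X l i) (gen X l j) (k + 1)).1 v =
      (altProd (gen X l j) (gen X l i) k).1 ((gen X l j).1 v) := rfl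

theorem altProd_zero_apply (i j : Fin (l + 1)) (v : DualCartan l) :
    (altProd (gen X l i) (gen X l j) 0).1 v = v := rfl

/-- When `a_{ij} a_{ji} = 4` the dihedral group is infinite, so `k` is unbounded and an invariant is
needed. The inequality `2y ≤ px` says that the vector pairs nonpositively with `α_j^∨`. Applying
`σ_j` replaces `y` by `px - y ≥ 0`, and `pq = 4` gives the same inequality with the roles of `i` and
`j` exchanged. -/
theorem altProd_apply_mem_of_affine (k : ℕ) (i j : Fin (l + 1)) (p q : ℕ) (hpq : p * q = 4)
    (hp : cartan X l j i = -p) (hq : cartan X l i j = -q) (x y : ℕ) (hxy : 2 * y ≤ p * x) :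
    (altProd (gen X l i) (gen X l j) k).1 (x • simpleRoot X l i + y • simpleRoot X l j) ∈
      AddSubmonoid.closure {simpleRoot X l i, simpleRoot X l j} := by
  induction k generalizing i j p q x y with
  | zero =>
    refine add_mem (nsmul_mem (AddSubmonoid.subset_closure (by simp)) _)
      (nsmul_mem (AddSubmonoid.subset_closure (by simp)) _)
  | succ k ih =>
    obtain ⟨z, hz⟩ : ∃ z, p * x = y + z := ⟨p * x - y, by omega⟩
    have h1 : (gen X l j).1 (x • simpleRoot X l i + y • simpleRoot X l j) =
        z • simpleRoot X l j + x • simpleRoot X l i := by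
      have h2 : (z : ℂ) = p * x - y := by
        rw [eq_sub_iff_add_eq']
        exact_mod_cast hz.symm
      rw [map_add, map_nsmul, map_nsmul, gen_apply_simpleRoot_self, gen_apply_simpleRoot, hp]
      simp only [← Nat.cast_smul_eq_nsmul ℂ]
      push_cast
      rw [h2]
      module
    rw [altProd_mul_apply, h1, Set.pair_comm]
    refine ih j i q p (by rw [mul_comm]; exact hpq) hq hp z x ?_
    have : q * (p * x) = 4 * x := by rw [← hpq]; ring
    rw [hz] at this
    have h3 : q * (2 * y) ≤ q * (p * x) := Nat.mul_le_mul_left _ hxy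
    rw [hz] at h3
    nlinarith

theorem gen_comm {i j : Fin (l + 1)} (h1 : cartan X l i j = 0) (h2 : cartan X l j i = 0) :
    gen X l i * gen X l j = gen X l j * gen X l i := by
  refine Subtype.ext (LinearEquiv.ext fun v => ?_)
  simp only [weyl_mul_apply, gen_apply, Prod.fst_sub, Prod.smul_fst, Pi.sub_apply, Pi.smul_apply,
    simpleRoot_fst, h1, h2, smul_eq_mul]
  push_cast
  module

theorem gen_braid_three {i j : Fin (l + 1)} (h1 : cartan X l i j = -1)
    (h2 : cartan X l j i = -1) :
    gen X l i * gen X l j * gen X l i = gen X l j * gen X l i * gen X l j := by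
  refine Subtype.ext (LinearEquiv.ext fun v => ?_)
  simp only [weyl_mul_apply, gen_apply, Prod.fst_sub, Prod.smul_fst, Pi.sub_apply, Pi.smul_apply,
    simpleRoot_fst, h1, h2, cartan_self, smul_eq_mul]
  push_cast
  module

theorem gen_braid_four {i j : Fin (l + 1)} (h1 : cartan X l i j = -1)
    (h2 : cartan X l j i = -2) :
    gen X l i * gen X l j * gen X l i * gen X l j =
      gen X l j * gen X l i * gen X l j * gen X l i := by
  refine Subtype.ext (LinearEquiv.ext fun v => ?_)
  simp only [weyl_mul_apply, gen_apply, Prod.fst_sub, Prod.smul_fst, Pi.sub_apply, Pi.smul_apply,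
    simpleRoot_fst, h1, h2, cartan_self, smul_eq_mul]
  push_cast
  module

/-- If `σ_iσ_j` has finite order `m`, the braid relation shortens the alternating word with `k + 1`
letters as soon as `k ≥ m`, against the hypothesis on length. The remaining `k < m` are computed one
by one. The case of infinite order is `altProd_apply_mem_of_affine`. -/
theorem altProd_apply_mem {i j : Fin (l + 1)} (hij : i ≠ j) (v : weylGroup X l) (k : ℕ)
    (h : length X l v + k <
      length X l (v * altProd (gen X l i) (gen X l j) k * gen X l i)) :
    (altProd (gen X l i) (gen X l j) k).1 (simpleRoot X l i) ∈
      AddSubmonoid.closure {simpleRoot X l i, simpleRoot X l j} := by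
  set s := gen X l i with hs
  set t := gen X l j with ht
  have hi : simpleRoot X l i ∈ AddSubmonoid.closure {simpleRoot X l i, simpleRoot X l j} :=
    AddSubmonoid.subset_closure (by simp)
  have hj : simpleRoot X l j ∈ AddSubmonoid.closure {simpleRoot X l i, simpleRoot X l j} :=
    AddSubmonoid.subset_closure (by simp)
  have ss (g : weylGroup X l) : g * s * s = g := mul_gen_mul_gen g i
  have length_s (g : weylGroup X l) : length X l (g * s) ≤ length X l g + 1 :=
    length_mul_gen_le g i
  have length_t (g : weylGroup X l) : length X l (g * t) ≤ length X l g + 1 :=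
    length_mul_gen_le g j
  have four (H : s * t * s * t = t * s * t * s) (n : ℕ)
      (h : length X l v + (n + 4) < length X l (v * altProd s t (n + 4) * s)) : False := by
    -- The last four letters are rewritten so as to end in `s`, which cancels against the final `s`.
    have e : v * altProd s t (n + 4) * s = v * altProd s t n * t * s * t := by
      have : altProd s t (n + 4) = altProd s t n * (s * t * s * t) := by
        simp only [altProd, mul_assoc]
      rw [this, H, ← mul_assoc, ← mul_assoc, ← mul_assoc, ← mul_assoc, ss]
    have h1 := length_t (v * altProd s t n * t * s)
    have h2 := length_s (v * altProd s t n * t)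
    have h3 := length_t (v * altProd s t n)
    have h4 : length X l (v * altProd s t n) ≤ length X l v + n := length_mul_altProd_le v i j n
    rw [e] at h
    omega
  rcases cartan_rank_two (X := X) hij with hc | hc | hc | hc | hc | hc
  · match k with
    | 0 => exact hi
    | 1 =>
      simp only [hs, ht, altProd_mul_apply, altProd_zero_apply, gen_apply_simpleRoot, hc.2,
        map_sub, map_smul]
      simpa using hi
    | n + 2 =>
      exfalso
      have e : v * altProd s t (n + 2) * s = v * altProd s t n * t := by
        have : altProd s t (n + 2) = altProd s t n * (s * t) := by simp only [altProd, mul_assoc]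
        rw [this, gen_comm hc.1 hc.2, ← mul_assoc, ← mul_assoc, ss]
      have h1 := length_t (v * altProd s t n)
      have h2 : length X l (v * altProd s t n) ≤ length X l v + n :=
        length_mul_altProd_le v i j n
      rw [e] at h
      omega
  · match k with
    | 0 => exact hi
    | 1 =>
      simp only [hs, ht, altProd_mul_apply, altProd_zero_apply, gen_apply_simpleRoot, hc.2,
        map_sub, map_smul]
      simpa using add_mem hi hj
    | 2 =>
      simp only [hs, ht, altProd_mul_apply, altProd_zero_apply, gen_apply_simpleRoot, cartan_self,
        hc.1, hc.2, map_sub, map_smul]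
      convert hj using 1
      push_cast
      module
    | n + 3 =>
      exfalso
      have e : v * altProd s t (n + 3) * s = v * altProd t s n * s * t := by
        have : altProd s t (n + 3) = altProd t s n * (t * s * t) := by
          simp only [altProd, mul_assoc]
        rw [this, ← gen_braid_three hc.1 hc.2, ← mul_assoc, ← mul_assoc, ← mul_assoc, ss]
      have h1 := length_t (v * altProd t s n * s)
      have h2 := length_s (v * altProd t s n)
      have h3 : length X l (v * altProd t s n) ≤ length X l v + n :=
        length_mul_altProd_le v j i n
      rw [e] at h
      omega
  · match k with
    | 0 => exact hi
    | 1 =>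
      simp only [hs, ht, altProd_mul_apply, altProd_zero_apply, gen_apply_simpleRoot, hc.2,
        map_sub, map_smul]
      convert add_mem hi (nsmul_mem hj 2) using 1
      rw [← Nat.cast_smul_eq_nsmul ℂ]
      push_cast
      module
    | 2 =>
      simp only [hs, ht, altProd_mul_apply, altProd_zero_apply, gen_apply_simpleRoot, cartan_self,
        hc.1, hc.2, map_sub, map_smul]
      convert add_mem hi (nsmul_mem hj 2) using 1
      rw [← Nat.cast_smul_eq_nsmul ℂ]
      push_cast
      module
    | 3 =>
      simp only [hs, ht, altProd_mul_apply, altProd_zero_apply, gen_apply_simpleRoot, cartan_self,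
        hc.1, hc.2, map_sub, map_smul]
      convert hi using 1
      push_cast
      module
    | n + 4 => exact (four (gen_braid_four hc.1 hc.2) n h).elim
  · match k with
    | 0 => exact hi
    | 1 =>
      simp only [hs, ht, altProd_mul_apply, altProd_zero_apply, gen_apply_simpleRoot, hc.2,
        map_sub, map_smul]
      simpa using add_mem hi hj
    | 2 =>
      simp only [hs, ht, altProd_mul_apply, altProd_zero_apply, gen_apply_simpleRoot, cartan_self,
        hc.1, hc.2, map_sub, map_smul]
      convert add_mem hi hj using 1
      push_cast
      module
    | 3 =>
      simp only [hs, ht, altProd_mul_apply, altProd_zero_apply, gen_apply_simpleRoot, cartan_self,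
        hc.1, hc.2, map_sub, map_smul]
      convert hi using 1
      push_cast
      module
    | n + 4 => exact (four (gen_braid_four hc.2 hc.1).symm n h).elim
  · simpa using altProd_apply_mem_of_affine k i j 1 4 rfl (by simpa using hc.2)
      (by simpa using hc.1) 1 0 (by norm_num)
  · simpa using altProd_apply_mem_of_affine k i j 4 1 rfl (by simpa using hc.2)
      (by simpa using hc.1) 1 0 (by norm_num)

/-- Induction on length. Choose a descent `j` of `w` and write `w = vu`, with `u` in the dihedral
group of `σ_i, σ_j` and `v` shortest in its coset. By rank two `uα_i` is a nonnegative combination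
of `α_i` and `α_j`. Both of these are kept positive by the shorter element `v`. -/
theorem apply_simpleRoot_mem_posCone (w : weylGroup X l) (i : Fin (l + 1))
    (h : length X l w < length X l (w * gen X l i)) : w.1 (simpleRoot X l i) ∈ posCone X l := by
  induction hn : length X l w using Nat.strong_induction_on generalizing w i with
  | _ n ih =>
    by_cases hw : w = 1
    · rw [hw]; exact simpleRoot_mem_posCone i
    obtain ⟨j, hj⟩ := exists_length_mul_gen_lt hw
    have hij : i ≠ j := by rintro rfl; omega
    obtain ⟨v, k, h1, h2, h3, h4⟩ := exists_eq_mul_altProd i j w h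
    -- The generator `σ_j` shortens `w` but lengthens `v`, so `v` is strictly shorter than `w` and
    -- the induction hypothesis applies to it.
    have hk : k ≠ 0 := by
      rintro rfl
      rw [altProd, mul_one] at h1
      rw [h1] at hj
      omega
    have hi := ih _ (by omega) v i h3 rfl
    have hj := ih _ (by omega) v j h4 rfl
    have hm := altProd_apply_mem hij v k (by rw [← h1]; omega)
    have hle : AddSubmonoid.closure {simpleRoot X l i, simpleRoot X l j} ≤
        (posCone X l).comap (v.1 : DualCartan l →ₗ[ℂ] DualCartan l).toAddMonoidHom := by
      rw [AddSubmonoid.closure_le]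
      rintro _ (rfl | rfl)
      · exact hi
      · exact hj
    rw [h1, weyl_mul_apply]
    exact hle hm

/-! ### The cone spanned by the simple roots is pointed -/

theorem exists_sum_of_mem_posCone {v : DualCartan l} (hv : v ∈ posCone X l) :
    ∃ n : Fin (l + 1) → ℕ, v = ∑ j, (n j : ℂ) • simpleRoot X l j := by
  induction hv using AddSubmonoid.closure_induction with
  | mem x hx =>
    obtain ⟨j, rfl⟩ := hx
    refine ⟨Pi.single j 1, ?_⟩
    rw [Finset.sum_eq_single j]
    · simp
    · intro b _ hb
      simp [hb]
    · simp
  | zero => exact ⟨0, by simp⟩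
  | add x y _ _ ihx ihy =>
    obtain ⟨n, hn⟩ := ihx
    obtain ⟨m, hm⟩ := ihy
    refine ⟨n + m, ?_⟩
    rw [hn, hm, ← Finset.sum_add_distrib]
    refine Finset.sum_congr rfl fun j _ => ?_
    rw [Pi.add_apply, Nat.cast_add, add_smul]

theorem snd_sum_simpleRoot (n : Fin (l + 1) → ℕ) :
    (∑ j, (n j : ℂ) • simpleRoot X l j).2 = n 0 := by
  rw [Prod.snd_sum, Finset.sum_eq_single 0]
  · simp [simpleRoot]
  · intro b _ hb
    simp [simpleRoot, hb]
  · simp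

theorem cartan_nonpos {i j : Fin (l + 1)} (h : i ≠ j) : cartan X l i j ≤ 0 := by
  have := cartan_rank_two (X := X) h
  omega

theorem cartan_of_lt {i j : Fin (l + 1)} (h : i < j) :
    cartan X l i j = (cartanPair l i j X).1 ∧ cartan X l j i = (cartanPair l i j X).2 := by
  simp [cartan, h, h.ne, h.ne', h.not_gt]

/-- A nonnegative combination of simple roots that does not involve `α_0` vanishes only if all
its coefficients do, since the Dynkin diagram is connected. -/
theorem eq_zero_of_sum_simpleRoot_eq_zero (hl : X.minRank ≤ l) (n : Fin (l + 1) → ℕ)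
    (h : ∑ j, (n j : ℂ) • simpleRoot X l j = 0) (j : Fin (l + 1)) : n j = 0 := by
  have h0 : n 0 = 0 := by
    have := snd_sum_simpleRoot (X := X) n
    rw [h] at this
    have h1 : (n 0 : ℂ) = 0 := this.symm
    exact_mod_cast h1
  have row (i : Fin (l + 1)) : ∑ j, (n j : ℤ) * cartan X l i j = 0 := by
    have h1 := congrFun (congrArg Prod.fst h) i
    rw [Prod.fst_sum, Finset.sum_apply] at h1
    have h2 : ∑ j, (n j : ℂ) * (cartan X l i j : ℂ) = 0 := h1
    exact_mod_cast h2
  -- With `n i = 0` the diagonal entry drops out of row `i`, so all its terms are nonpositive and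
  -- each one vanishes. Vanishing thus spreads from a vertex to its neighbours, starting at `0`,
  -- where the last coordinate gives it.
  have step (i j : Fin (l + 1)) (hi : n i = 0) (hij : i ≠ j) (hc : cartan X l i j ≠ 0) :
      n j = 0 := by
    have h1 : ∀ j ∈ Finset.univ, (n j : ℤ) * cartan X l i j ≤ 0 := by
      intro j _
      rcases eq_or_ne i j with rfl | hj
      · simp [hi]
      · exact mul_nonpos_of_nonneg_of_nonpos (by positivity) (cartan_nonpos hj)
    have h2 := (Finset.sum_eq_zero_iff_of_nonpos h1).1 (row i) j (Finset.mem_univ j)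
    simpa [hc] using h2
  have chain (i j : ℕ) (hi : i < j) (hj : j < l + 1) (hc : (cartanPair l i j X).1 ≠ 0)
      (hn : n ⟨i, by omega⟩ = 0) : n ⟨j, hj⟩ = 0 := by
    refine step ⟨i, by omega⟩ ⟨j, hj⟩ hn (by simp; omega) ?_
    rw [(cartan_of_lt (by simpa using hi)).1]
    exact hc
  have back (i j : ℕ) (hi : i < j) (hj : j < l + 1) (hc : (cartanPair l i j X).2 ≠ 0)
      (hn : n ⟨j, hj⟩ = 0) : n ⟨i, by omega⟩ = 0 := by
    refine step ⟨j, hj⟩ ⟨i, by omega⟩ hn (by simp; omega) ?_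
    rw [(cartan_of_lt (by simpa using hi)).2]
    exact hc
  have key : ∀ (j : ℕ) (hj : j < l + 1), n ⟨j, hj⟩ = 0 := by
    intro j
    induction j using Nat.strong_induction_on with
    | _ j ih =>
      intro hj
      rcases Nat.eq_zero_or_pos j with rfl | hpos
      · exact h0
      cases X <;> simp only [minRank] at hl
      case C1 | A2even | D2 =>
        refine chain (j - 1) j (by omega) hj ?_ (ih _ (by omega) _)
        simp only [cartanPair]
        split_ifs <;> omega
      case A2odd | B1 =>
        have h2 : n ⟨2, by omega⟩ = 0 := chain 0 2 (by omega) (by omega) (by simp [cartanPair]) h0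
        rcases eq_or_ne j 1 with rfl | hj1
        · refine back 1 2 (by omega) (by omega) ?_ h2
          simp only [cartanPair]
          split_ifs <;> omega
        · rcases eq_or_ne j 2 with rfl | hj2
          · exact h2
          refine chain (j - 1) j (by omega) hj ?_ (ih _ (by omega) _)
          simp only [cartanPair]
          split_ifs <;> omega
      case D1 =>
        have h2 : n ⟨2, by omega⟩ = 0 := chain 0 2 (by omega) (by omega) (by simp [cartanPair]) h0
        rcases eq_or_ne j 1 with rfl | hj1
        · refine back 1 2 (by omega) (by omega) ?_ h2
          simp only [cartanPair]
          split_ifs <;> omega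
        · rcases eq_or_ne j 2 with rfl | hj2
          · exact h2
          by_cases hjl : j = l
          · refine chain (j - 2) j (by omega) hj ?_ (ih _ (by omega) _)
            simp only [cartanPair]
            split_ifs <;> omega
          · refine chain (j - 1) j (by omega) hj ?_ (ih _ (by omega) _)
            simp only [cartanPair]
            split_ifs <;> omega
  exact key j j.2

theorem eq_zero_of_mem_posCone_of_neg_mem (hl : X.minRank ≤ l) {v : DualCartan l}
    (h1 : v ∈ posCone X l) (h2 : -v ∈ posCone X l) : v = 0 := by
  obtain ⟨n, hn⟩ := exists_sum_of_mem_posCone h1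
  obtain ⟨m, hm⟩ := exists_sum_of_mem_posCone h2
  have h3 : ∑ j, ((n + m) j : ℂ) • simpleRoot X l j = 0 := by
    simp only [Pi.add_apply, Nat.cast_add, add_smul, Finset.sum_add_distrib]
    rw [← hn, ← hm, add_neg_cancel]
  have h4 := eq_zero_of_sum_simpleRoot_eq_zero hl (n + m) (by simpa using h3)
  rw [hn]
  refine Finset.sum_eq_zero fun j _ => ?_
  have := h4 j
  rw [Pi.add_apply] at this
  have h5 : n j = 0 := by omega
  simp [h5]

theorem simpleRoot_ne_zero (i : Fin (l + 1)) : simpleRoot X l i ≠ 0 := by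
  intro h
  have := congrFun (congrArg Prod.fst h) i
  rw [simpleRoot_fst, cartan_self] at this
  norm_num at this

theorem apply_simpleRoot_ne_zero (w : weylGroup X l) (i : Fin (l + 1)) :
    w.1 (simpleRoot X l i) ≠ 0 := by
  rw [Ne, LinearEquiv.map_eq_zero_iff]
  exact simpleRoot_ne_zero i

/-! ### The stabilizer of the fundamental weight `Λ_0` -/

/-- The fundamental weight `Λ_0`. -/
def fundamentalWeight (l : ℕ) : DualCartan l := (Pi.single 0 1, 0)

theorem gen_zero_apply_fundamentalWeight :
    (gen X l 0).1 (fundamentalWeight l) = fundamentalWeight l - simpleRoot X l 0 := by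
  rw [gen_apply]
  simp [fundamentalWeight]

theorem gen_apply_fundamentalWeight {i : Fin (l + 1)} (hi : i ≠ 0) :
    (gen X l i).1 (fundamentalWeight l) = fundamentalWeight l := by
  rw [gen_apply]
  simp [fundamentalWeight, hi]

/-- Only the letters `0` move `Λ_0`, and `Λ_0 - uσ_0Λ_0 = (Λ_0 - uΛ_0) + uα_0`. Prefixes of a
reduced word are reduced, so each `uα_0` is positive. These terms cannot cancel because the cone is
pointed. -/
theorem fundamentalWeight_sub_mem (hl : X.minRank ≤ l) (ws : List (Fin (l + 1)))
    (h : ws.length = length X l (ws.map (gen X l)).prod) :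
    fundamentalWeight l - (ws.map (gen X l)).prod.1 (fundamentalWeight l) ∈ posCone X l ∧
      (0 ∈ ws →
        fundamentalWeight l - (ws.map (gen X l)).prod.1 (fundamentalWeight l) ≠ 0) := by
  induction ws using List.reverseRecOn with
  | nil => simp
  | append_singleton u i ih =>
    rw [List.map_append, List.prod_append, List.map_singleton, List.prod_singleton] at h ⊢
    rw [List.length_append, List.length_singleton] at h
    have h1 := length_le (X := X) u
    have h2 := length_mul_gen_le (u.map (gen X l)).prod i
    obtain ⟨h3, h4⟩ := ih (by omega)
    have h5 := apply_simpleRoot_mem_posCone (u.map (gen X l)).prod i (by omega)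
    rw [weyl_mul_apply]
    rcases eq_or_ne i 0 with rfl | hi
    · rw [gen_zero_apply_fundamentalWeight, map_sub, ← sub_add]
      refine ⟨add_mem h3 h5, fun _ h6 => ?_⟩
      refine apply_simpleRoot_ne_zero (u.map (gen X l)).prod 0
        (eq_zero_of_mem_posCone_of_neg_mem hl h5 ?_)
      rwa [← eq_neg_of_add_eq_zero_left h6]
    · rw [gen_apply_fundamentalWeight hi]
      refine ⟨h3, fun h6 => h4 ?_⟩
      simpa [hi.symm] using h6

theorem snd_prod_apply (ws : List (Fin (l + 1))) (h : 0 ∉ ws) (v : DualCartan l) :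
    ((ws.map (gen X l)).prod.1 v).2 = v.2 := by
  induction ws with
  | nil => rfl
  | cons i ws ih =>
    simp only [List.mem_cons, not_or] at h
    rw [List.map_cons, List.prod_cons, weyl_mul_apply, gen_apply, Prod.snd_sub, ih h.2]
    simp [simpleRoot, Ne.symm h.1]

theorem grassmannian_apply_simpleRoot_mem {w : weylGroup X l} (hw : w ∈ grassmannian X l)
    {i : Fin (l + 1)} (hi : i ≠ 0) : w.1 (simpleRoot X l i) ∈ posCone X l :=
  apply_simpleRoot_mem_posCone w i (hw i hi)

/-- The element `w⁻¹w'` fixes `Λ_0`, so a reduced word for it has no letter `0`. If it ended in a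
letter `i`, say `w⁻¹w' = uσ_i`, then `uα_i` would be a nonnegative combination of the `α_j` with `j
≠ 0`, which `w` keeps positive. But `wuα_i = -w'α_i`, and `w'α_i` is positive too. -/
theorem grassmannian_eq_of_apply_eq (hl : X.minRank ≤ l) {w w' : weylGroup X l}
    (hw : w ∈ grassmannian X l) (hw' : w' ∈ grassmannian X l)
    (h : w.1 (fundamentalWeight l) = w'.1 (fundamentalWeight l)) : w = w' := by
  obtain ⟨ws, h1, h2⟩ := exists_reduced_word (w⁻¹ * w')
  have h3 : (w⁻¹ * w').1 (fundamentalWeight l) = fundamentalWeight l := by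
    rw [weyl_mul_apply, ← h, ← weyl_mul_apply, inv_mul_cancel]
    rfl
  have h0 : 0 ∉ ws := fun h4 =>
    (fundamentalWeight_sub_mem hl ws (by rw [h1, h2])).2 h4 (by rw [h2, h3, sub_self])
  rcases List.eq_nil_or_concat ws with rfl | ⟨u, i, rfl⟩
  · exact inv_mul_eq_one.1 h2.symm
  · exfalso
    rw [List.concat_eq_append] at h0 h1 h2
    simp only [List.mem_append, List.mem_singleton, not_or] at h0
    rw [List.map_append, List.prod_append, List.map_singleton, List.prod_singleton] at h2
    rw [List.length_append, List.length_singleton, ← h2] at h1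
    have h4 := length_le (X := X) u
    have hi : i ≠ 0 := Ne.symm h0.2
    have h5 := apply_simpleRoot_mem_posCone (u.map (gen X l)).prod i (by omega)
    -- The last coordinate reads off the coefficient of `α_0`, and generators other than `σ_0` do
    -- not change it.
    have h6 := snd_prod_apply (X := X) u h0.1 (simpleRoot X l i)
    obtain ⟨n, hn⟩ := exists_sum_of_mem_posCone h5
    have hn0 : n 0 = 0 := by
      rw [hn, snd_sum_simpleRoot] at h6
      have h7 : (simpleRoot X l i).2 = 0 := by simp [simpleRoot, hi]
      rw [h7] at h6
      exact_mod_cast h6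
    have h7 : w.1 ((u.map (gen X l)).prod.1 (simpleRoot X l i)) ∈ posCone X l := by
      rw [hn, map_sum]
      refine sum_mem fun j _ => ?_
      rw [map_smul, Nat.cast_smul_eq_nsmul]
      rcases eq_or_ne j 0 with rfl | hj
      · simp [hn0]
      · exact nsmul_mem (grassmannian_apply_simpleRoot_mem hw hj) _
    have h8 : w.1 ((u.map (gen X l)).prod.1 (simpleRoot X l i)) = -w'.1 (simpleRoot X l i) := by
      have h9 : w' * gen X l i = w * (u.map (gen X l)).prod := by
        rw [← mul_gen_mul_gen (u.map (gen X l)).prod i, h2, ← mul_assoc, ← mul_assoc,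
          mul_inv_cancel, one_mul]
      rw [← weyl_mul_apply, ← h9, weyl_mul_apply, gen_apply_simpleRoot_self, map_neg]
    rw [h8] at h7
    exact apply_simpleRoot_ne_zero w' i (eq_zero_of_mem_posCone_of_neg_mem hl
      (grassmannian_apply_simpleRoot_mem hw' hi) h7)

/-! ### `β`-sets of partitions -/

theorem strictMono_neg_beta (μ : YoungDiagram) :
    StrictMono fun i : ℕ => -((μ.rowLen i : ℤ) - (i + 1)) := by
  intro i j hij
  have := μ.rowLen_anti i j hij.le
  dsimp only
  omega

theorem betaSet_injective : Function.Injective betaSet := by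
  intro μ ν h
  have h1 : Set.range (fun i : ℕ => -((μ.rowLen i : ℤ) - (i + 1))) =
      Set.range (fun i : ℕ => -((ν.rowLen i : ℤ) - (i + 1))) := by
    ext x
    have h2 : -x ∈ betaSet μ ↔ -x ∈ betaSet ν := by rw [h]
    simp only [betaSet, Set.mem_ofPred_eq] at h2
    simp only [Set.mem_range, neg_eq_iff_eq_neg]
    simpa only [eq_comm] using h2
  have h3 := ((strictMono_neg_beta μ).range_inj (strictMono_neg_beta ν)).1 h1
  have h4 (i : ℕ) : μ.rowLen i = ν.rowLen i := by
    have := congrFun h3 i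
    omega
  refine YoungDiagram.ext (Finset.ext fun c => ?_)
  rw [YoungDiagram.mem_cells, YoungDiagram.mem_cells]
  exact (YoungDiagram.mem_iff_lt_rowLen (i := c.1) (j := c.2)).trans
    ((by rw [h4] : c.2 < μ.rowLen c.1 ↔ c.2 < ν.rowLen c.1).trans
      YoungDiagram.mem_iff_lt_rowLen.symm)

theorem lt_rowLen_iff_lt_colLen (μ : YoungDiagram) (i j : ℕ) :
    j < μ.rowLen i ↔ i < μ.colLen j :=
  YoungDiagram.mem_iff_lt_rowLen.symm.trans YoungDiagram.mem_iff_lt_colLen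

/-- The gaps of the `β`-set are read off the columns of the Young diagram. -/
theorem notMem_betaSet_iff (μ : YoungDiagram) (y : ℤ) :
    y ∉ betaSet μ ↔ ∃ j : ℕ, y = j - μ.colLen j := by
  constructor
  · intro hy
    have hex : ∃ i : ℕ, (μ.rowLen i : ℤ) - (i + 1) < y := by
      refine ⟨μ.rowLen 0 + (-y).toNat, ?_⟩
      have := μ.rowLen_anti 0 (μ.rowLen 0 + (-y).toNat) (Nat.zero_le _)
      omega
    classical
    -- Here `i` is the number of rows whose β-number exceeds the gap `y`, and the column `y + i`
    -- turns out to have length exactly `i`. The argument of `toNat` is nonnegative because the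
    -- `i`-th β-number is at least `-(i + 1)`.
    have h1 := Nat.find_spec hex
    set i := Nat.find hex with hi
    refine ⟨(y + i).toNat, ?_⟩
    have h2 : ¬ i < μ.colLen (y + i).toNat := by
      rw [← lt_rowLen_iff_lt_colLen]
      omega
    have h3 : i ≤ μ.colLen (y + i).toNat := by
      by_contra! h
      obtain ⟨k, hk⟩ : ∃ k, i = k + 1 := ⟨i - 1, by omega⟩
      have h4 := Nat.find_min hex (m := k) (by omega)
      have h5 : y ≠ (μ.rowLen k : ℤ) - (k + 1) := fun h => hy ⟨k, h⟩
      have h6 := (lt_rowLen_iff_lt_colLen μ k (y + i).toNat).1 (by omega)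
      omega
    omega
  · rintro ⟨j, hj⟩ ⟨i, hi⟩
    have := lt_rowLen_iff_lt_colLen μ i j
    omega

theorem mem_betaSet_transpose (μ : YoungDiagram) (y : ℤ) :
    y ∈ betaSet μ.transpose ↔ -1 - y ∉ betaSet μ := by
  rw [notMem_betaSet_iff]
  simp only [betaSet, Set.mem_ofPred_eq, YoungDiagram.rowLen_transpose]
  refine exists_congr fun j => ?_
  omega

/-- `D` is dual to its reflection `y ↦ s - y`; a fixed point of the reflection lies in `D`. -/
def SelfDual (s : ℤ) (D : Set ℤ) : Prop :=
  ∀ y, y ∈ D ↔ (s - y ∉ D ∨ 2 * y = s)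

theorem isSelfConjugate_iff (μ : YoungDiagram) :
    IsSelfConjugate μ ↔ SelfDual (-1) (betaSet μ) := by
  rw [IsSelfConjugate, ← betaSet_injective.eq_iff, Set.ext_iff]
  refine forall_congr' fun y => ?_
  rw [mem_betaSet_transpose, eq_false (by omega : ¬ 2 * y = -1), or_false]
  exact Iff.comm

/-- The nonnegative beads are the arms at the diagonal nodes, and the negative gaps are `-1` minus
the legs. Legs exceeding arms by one means that `y ↦ -2 - y` matches beads with gaps away from the
fixed point `-1`, which has to be a bead since a leg of length `0` would require a negative arm. -/
theorem isDoubledDistinct_iff (μ : YoungDiagram) :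
    IsDoubledDistinct μ ↔ SelfDual (-2) (betaSet μ) := by
  have diag (i : ℕ) : (i, i) ∈ μ ↔ i < μ.rowLen i := YoungDiagram.mem_iff_lt_rowLen
  have diag' (i : ℕ) : (i, i) ∈ μ ↔ i < μ.colLen i := YoungDiagram.mem_iff_lt_colLen
  constructor
  · intro h
    have pos (y : ℤ) (hy : 0 ≤ y) : y ∈ betaSet μ ↔ -2 - y ∉ betaSet μ := by
      rw [notMem_betaSet_iff]
      refine exists_congr fun i => ?_
      have h1 := h i
      have h2 := diag i
      have h3 := diag' i
      constructor
      · intro h4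
        have := h1 (h2.2 (by omega))
        omega
      · intro h4
        have := h1 (h3.2 (by omega))
        omega
    intro y
    rcases lt_trichotomy y (-1) with hy | rfl | hy
    · have := pos (-2 - y) (by omega)
      rw [show -2 - (-2 - y) = y by ring] at this
      rw [this, not_not, eq_false (by omega : ¬ 2 * y = -2), or_false]
    · simp only [mul_neg, mul_one, or_true, iff_true]
      by_contra h0
      obtain ⟨i, hi⟩ := (notMem_betaSet_iff μ (-1)).1 h0
      have h1 := (diag' i).2 (by omega)
      have h2 := h i h1
      have h3 := (diag i).1 h1
      omega
    · rw [pos y (by omega), eq_false (by omega : ¬ 2 * y = -2), or_false]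
  · intro h
    have h1 : (-1 : ℤ) ∈ betaSet μ := (h (-1)).2 (Or.inr rfl)
    have gap (i : ℕ) (hi : (i, i) ∈ μ) : i + 2 ≤ μ.colLen i := by
      have h2 := (diag' i).1 hi
      by_contra! h3
      exact (notMem_betaSet_iff μ (-1)).2 ⟨i, by omega⟩ h1
    -- Arms and legs minus one, negated so as to increase along the diagonal. Duality shows that
    -- they have the same range, and strictly monotone enumerations of the same set agree.
    let f : {i : ℕ // (i, i) ∈ μ} → ℤ := fun i => -((μ.rowLen i : ℤ) - (i + 1))
    let g : {i : ℕ // (i, i) ∈ μ} → ℤ := fun i => -((μ.colLen i : ℤ) - (i + 2))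
    have hf : StrictMono f := fun i j hij => strictMono_neg_beta μ hij
    have hg : StrictMono g := by
      intro i j hij
      have h2 := μ.colLen_anti i j hij.le
      have h3 : (i : ℕ) < j := hij
      simp only [g]
      omega
    have hfg : Set.range f = Set.range g := by
      ext x
      constructor
      · rintro ⟨i, rfl⟩
        have h2 := (diag i).1 i.2
        have h3 : (μ.rowLen i : ℤ) - (i + 1) ∈ betaSet μ := ⟨i, rfl⟩
        rw [h, eq_false (by omega : ¬ 2 * ((μ.rowLen i : ℤ) - (i + 1)) = -2), or_false,
          notMem_betaSet_iff] at h3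
        obtain ⟨j, hj⟩ := h3
        refine ⟨⟨j, (diag' j).2 (by omega)⟩, ?_⟩
        simp only [f, g]
        omega
      · rintro ⟨i, rfl⟩
        have h2 := gap i i.2
        have h3 : ((i : ℕ) : ℤ) - μ.colLen i ∉ betaSet μ := (notMem_betaSet_iff μ _).2 ⟨i, rfl⟩
        rw [h, not_or, not_not] at h3
        obtain ⟨⟨j, hj⟩, -⟩ := h3
        refine ⟨⟨j, (diag j).2 (by omega)⟩, ?_⟩
        simp only [f, g]
        omega
    have h2 := (hf.range_inj hg).1 hfg
    intro i hi
    have h3 := congrFun h2 ⟨i, hi⟩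
    simp only [f, g] at h3
    omega

theorem card_diagonal (μ : YoungDiagram) :
    (μ.cells.filter (fun c => c.1 = c.2)).card = (betaSet μ ∩ Set.Ici 0).ncard := by
  have h : betaSet μ ∩ Set.Ici 0 = (fun c : ℕ × ℕ => (μ.rowLen c.1 : ℤ) - (c.1 + 1)) ''
      (μ.cells.filter (fun c => c.1 = c.2) : Finset (ℕ × ℕ)) := by
    ext x
    constructor
    · rintro ⟨⟨i, rfl⟩, hi⟩
      refine ⟨(i, i), ?_, rfl⟩
      rw [Set.mem_Ici] at hi
      simp only [Finset.coe_filter, YoungDiagram.mem_cells, Set.mem_ofPred_eq, and_true]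
      exact YoungDiagram.mem_iff_lt_rowLen.2 (by omega)
    · rintro ⟨⟨i, j⟩, hc, rfl⟩
      simp only [Finset.coe_filter, YoungDiagram.mem_cells, Set.mem_ofPred_eq] at hc
      obtain ⟨hc, rfl⟩ := hc
      refine ⟨⟨i, rfl⟩, ?_⟩
      have := YoungDiagram.mem_iff_lt_rowLen.1 hc
      rw [Set.mem_Ici]
      dsimp only
      omega
  rw [h, Set.InjOn.ncard_image, Set.ncard_coe_finset]
  rintro ⟨i, j⟩ hc ⟨i', j'⟩ hc' heq
  simp only [Finset.coe_filter, YoungDiagram.mem_cells, Set.mem_ofPred_eq] at hc hc'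
  obtain ⟨hc, rfl⟩ := hc
  obtain ⟨hc', rfl⟩ := hc'
  have : i = i' := (strictMono_neg_beta μ).injective (neg_inj.2 heq)
  rw [this]

theorem exists_betaSet_bound (μ : YoungDiagram) :
    ∃ M : ℕ, (∀ x ∈ betaSet μ, x < M) ∧ ∀ x : ℤ, x < -M → x ∈ betaSet μ := by
  refine ⟨μ.rowLen 0 + μ.colLen 0, ?_, ?_⟩
  · rintro x ⟨i, rfl⟩
    have := μ.rowLen_anti 0 i (Nat.zero_le _)
    push_cast
    omega
  · intro x hx
    by_contra h
    obtain ⟨j, hj⟩ := (notMem_betaSet_iff μ x).1 h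
    have := μ.colLen_anti 0 j (Nat.zero_le _)
    push_cast at hx
    omega

open Classical in
/-- A set of integers of charge `0` is the `β`-set of a partition. -/
theorem exists_betaSet_eq {D : Set ℤ} {M : ℕ} (h1 : ∀ x ∈ D, x < M)
    (h2 : ∀ x : ℤ, x < -M → x ∈ D)
    (h3 : ((Finset.Ico (-M : ℤ) M).filter (· ∈ D)).card = M) :
    ∃ μ : YoungDiagram, betaSet μ = D := by
  -- The beads are read downwards from `M - 1`. The `i`-th one is `M - 1 - Nat.nth p i`, so row `i`
  -- must have length `M + i - Nat.nth p i`. The charge condition makes this vanish for `i ≥ M`.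
  let p : ℕ → Prop := fun n => (M : ℤ) - 1 - n ∈ D
  have hp : ∀ n, 2 * M ≤ n → p n := fun n hn => h2 _ (by omega)
  have hinf : (Set.ofPred p).Infinite :=
    Set.infinite_of_injective_forall_mem (f := fun n : ℕ => 2 * M + n)
      (fun a b h => by simpa using h) fun n => hp _ (by omega)
  have hcount : Nat.count p (2 * M) = M := by
    rw [Nat.count_eq_card_filter_range]
    refine Eq.trans ?_ h3
    refine Finset.card_bij (fun n _ => (M : ℤ) - 1 - n) ?_ ?_ ?_
    · intro n hn
      rw [Finset.mem_filter, Finset.mem_range] at hn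
      rw [Finset.mem_filter, Finset.mem_Ico]
      exact ⟨by omega, hn.2⟩
    · intro a _ b _ h
      omega
    · intro x hx
      rw [Finset.mem_filter, Finset.mem_Ico] at hx
      refine ⟨(M - 1 - x).toNat, ?_, by omega⟩
      rw [Finset.mem_filter, Finset.mem_range]
      refine ⟨by omega, ?_⟩
      have : (M : ℤ) - 1 - ((M - 1 - x).toNat : ℤ) = x := by omega
      simp only [p, this, hx.2]
  have hcount' : ∀ k, Nat.count p (2 * M + k) = M + k := by
    intro k
    induction k with
    | zero => exact hcount
    | succ k ih =>
      rw [← add_assoc, Nat.count_succ, ih, if_pos (hp _ (by omega)), add_assoc]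
  have hnth : ∀ k, Nat.nth p (M + k) = 2 * M + k := by
    intro k
    rw [← hcount' k, Nat.nth_count (hp _ (by omega))]
  have hmono := Nat.nth_strictMono hinf
  have hgap : ∀ i k, Nat.nth p i + k ≤ Nat.nth p (i + k) := by
    intro i k
    induction k with
    | zero => exact le_rfl
    | succ k ih =>
      have : Nat.nth p (i + k) < Nat.nth p (i + (k + 1)) := hmono (by omega)
      omega
  have hle : ∀ i, Nat.nth p i ≤ M + i := by
    intro i
    rcases le_or_gt M i with h | h
    · have := hnth (i - M)
      rw [show M + (i - M) = i by omega] at this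
      omega
    · have := hgap i (M - i)
      rw [show i + (M - i) = M + 0 by omega, hnth 0] at this
      omega
  have hzero : ∀ i, M ≤ i → Nat.nth p i = M + i := by
    intro i h
    have := hnth (i - M)
    rw [show M + (i - M) = i by omega] at this
    omega
  let μ : YoungDiagram :=
    { cells := ((Finset.range M) ×ˢ (Finset.range (2 * M))).filter
        fun c => c.2 + Nat.nth p c.1 < M + c.1
      isLowerSet := by
        rintro ⟨i, j⟩ ⟨i', j'⟩ hle hc
        obtain ⟨hi, hj⟩ := Prod.mk_le_mk.1 hle
        simp only [Finset.coe_filter, Finset.mem_product, Finset.mem_range, Set.mem_ofPred_eq]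
          at hc ⊢
        have := hgap i' (i - i')
        rw [show i' + (i - i') = i by omega] at this
        omega }
  have hμ : ∀ i, μ.rowLen i + Nat.nth p i = M + i := by
    intro i
    have h4 (j : ℕ) : j < μ.rowLen i ↔ j + Nat.nth p i < M + i := by
      rw [← YoungDiagram.mem_iff_lt_rowLen]
      change (i, j) ∈ Finset.filter _ _ ↔ _
      simp only [Finset.mem_filter, Finset.mem_product, Finset.mem_range]
      refine ⟨fun h => h.2, fun h => ⟨?_, h⟩⟩
      have := hzero i
      omega
    have h5 := h4 (μ.rowLen i)
    have h6 := h4 (M + i - Nat.nth p i)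
    have := hle i
    omega
  refine ⟨μ, Set.ext fun x => ?_⟩
  constructor
  · rintro ⟨i, rfl⟩
    have h4 := Nat.nth_mem_of_infinite hinf i
    have h5 := hμ i
    have h6 : (μ.rowLen i : ℤ) - (i + 1) = M - 1 - Nat.nth p i := by omega
    rw [h6]
    exact h4
  · intro hx
    have h4 := h1 x hx
    have h5 : p (M - 1 - x).toNat := by
      have : (M : ℤ) - 1 - ((M - 1 - x).toNat : ℤ) = x := by omega
      simp only [p, this, hx]
    have h6 : (M - 1 - x).toNat ∈ Set.range (Nat.nth p) := by
      rw [Nat.range_nth_of_infinite hinf]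
      exact h5
    obtain ⟨i, hi⟩ := h6
    refine ⟨i, ?_⟩
    have := hμ i
    omega

theorem exists_betaSet_eq_of_selfDual {s : ℤ} (hs : s = -1 ∨ s = -2) {D : Set ℤ} {N : ℕ}
    (h1 : ∀ x ∈ D, x < N) (h2 : ∀ x : ℤ, x < -N → x ∈ D) (h : SelfDual s D) :
    ∃ μ : YoungDiagram, betaSet μ = D := by
  classical
  refine exists_betaSet_eq (M := N + 1) (fun x hx => ?_) (fun x hx => ?_) ?_
  · have := h1 x hx
    push_cast
    omega
  · push_cast at hx
    exact h2 x (by omega)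
  have hsum := Finset.card_filter_add_card_filter_not
    (s := Finset.Ico (-(N + 1 : ℕ) : ℤ) (N + 1 : ℕ)) (· ∈ D)
  rw [Int.card_Ico] at hsum
  suffices ((Finset.Ico (-(N + 1 : ℕ) : ℤ) (N + 1 : ℕ)).filter (· ∈ D)).card =
      ((Finset.Ico (-(N + 1 : ℕ) : ℤ) (N + 1 : ℕ)).filter (¬ · ∈ D)).card by omega
  -- The reflection matches beads with gaps in the window. For `s = -2` the window is not symmetric:
  -- the bead at the fixed point `-1` has no partner, and the gap at `N` reflects out of the window,
  -- so these two are matched with each other.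
  refine Finset.card_bij (fun x _ => if 2 * x = s then (N : ℤ) else s - x) ?_ ?_ ?_
  · intro x hx
    rw [Finset.mem_filter, Finset.mem_Ico] at hx ⊢
    push_cast at hx ⊢
    have h3 := h1 x hx.2
    split_ifs with hxs
    · exact ⟨by omega, fun h4 => absurd (h1 _ h4) (lt_irrefl _)⟩
    · have h4 := (h x).1 hx.2
      rw [or_iff_left hxs] at h4
      refine ⟨?_, h4⟩
      have h5 : ¬ s - x < -N := fun h5 => h4 (h2 _ h5)
      omega
  · intro x hx y hy hxy
    rw [Finset.mem_filter, Finset.mem_Ico] at hx hy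
    push_cast at hx hy
    split_ifs at hxy <;> omega
  · intro y hy
    rw [Finset.mem_filter, Finset.mem_Ico] at hy
    push_cast at hy
    have h3 := h y
    rw [eq_false hy.2, false_iff, not_or, not_not] at h3
    by_cases hyN : s = -2 ∧ y = N
    · refine ⟨-1, ?_, by rw [if_pos (by omega), hyN.2]⟩
      rw [Finset.mem_filter, Finset.mem_Ico]
      exact ⟨by omega, (h (-1)).2 (Or.inr (by omega))⟩
    · refine ⟨s - y, ?_, by rw [if_neg (by omega)]; omega⟩
      rw [Finset.mem_filter, Finset.mem_Ico]
      push_cast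
      exact ⟨by omega, h3.1⟩

/-! ### Abaci with prescribed charges of the runners -/

/-- The first empty place of the runner `r` in the full abacus with charges `c`. -/
def threshold (l : ℕ) (m : ℤ) (c : ℕ → ℤ) (r : ℤ) : ℤ :=
  if r < l then c r.toNat else if m - l ≤ r ∧ r < m then -c (m - 1 - r).toNat else 0

/-- The full abacus with `e` runners in which the runners `a - 1` and `m - a` have charges
`c (a - 1)` and `-c (a - 1)`, for `1 ≤ a ≤ l`. -/
def fullAbacus (l : ℕ) (e m : ℤ) (c : ℕ → ℤ) : Set ℤ :=
  {x | x / e < threshold l m c (x % e)}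

/-- The numerical conditions on the number `e` of runners and the length `m` of the block of
runners symmetric about its centre. -/
def Admissible (l : ℕ) (e m : ℤ) : Prop :=
  1 ≤ l ∧ (m = 2 * l ∨ m = 2 * l + 1) ∧ (e = m ∨ e = m + 1)

theorem Admissible.pos {l : ℕ} {e m : ℤ} (h : Admissible l e m) : 0 < e := by
  obtain ⟨h1, h2, h3⟩ := h
  omega

/-- The charges vanish at the indices that do not label runners. -/
def Supported (l : ℕ) (c : ℕ → ℤ) : Prop := ∀ j, l ≤ j → c j = 0

theorem exists_coord {e : ℤ} (he : 0 < e) (x : ℤ) :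
    ∃ k r : ℤ, 0 ≤ r ∧ r < e ∧ x = k * e + r :=
  ⟨x / e, x % e, Int.emod_nonneg _ he.ne', Int.emod_lt_of_pos _ he,
    by rw [mul_comm]; exact (Int.mul_ediv_add_emod x e).symm⟩

theorem coord_div {e k r : ℤ} (h0 : 0 ≤ r) (h1 : r < e) : (k * e + r) / e = k := by
  rw [add_comm, Int.add_mul_ediv_right _ _ (by omega), Int.ediv_eq_zero_of_lt h0 h1, zero_add]

theorem coord_mod {e k r : ℤ} (h0 : 0 ≤ r) (h1 : r < e) : (k * e + r) % e = r := by
  rw [add_comm, Int.add_mul_emod_self_right, Int.emod_eq_of_lt h0 h1]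

theorem coord_inj {e k r k' r' : ℤ} (h0 : 0 ≤ r) (h1 : r < e) (h0' : 0 ≤ r') (h1' : r' < e) :
    k * e + r = k' * e + r' ↔ k = k' ∧ r = r' := by
  refine ⟨fun h => ⟨?_, ?_⟩, fun h => by rw [h.1, h.2]⟩
  · rw [← coord_div (k := k) h0 h1, h, coord_div h0' h1']
  · rw [← coord_mod (k := k) h0 h1, h, coord_mod h0' h1']

theorem coord_nonneg {e k r : ℤ} (h0 : 0 ≤ r) (h1 : r < e) : 0 ≤ k * e + r ↔ 0 ≤ k := by
  rw [← Int.ediv_nonneg_iff_of_pos (show 0 < e by omega), coord_div h0 h1]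

theorem mem_fullAbacus {l : ℕ} {e m k r : ℤ} {c : ℕ → ℤ} (h0 : 0 ≤ r) (h1 : r < e) :
    k * e + r ∈ fullAbacus l e m c ↔ k < threshold l m c r := by
  rw [fullAbacus, Set.mem_ofPred_eq, coord_div h0 h1, coord_mod h0 h1]

theorem threshold_reflect {l : ℕ} {e m r : ℤ} (h : Admissible l e m) (c : ℕ → ℤ) (h0 : 0 ≤ r)
    (h1 : r < m) : threshold l m c (m - 1 - r) = -threshold l m c r := by
  obtain ⟨hl, hm, he⟩ := h
  have h2 : m - 1 - (m - 1 - r) = r := by ring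
  simp only [threshold, h2]
  split_ifs <;> omega

theorem threshold_of_ge {l : ℕ} {e m r : ℤ} (h : Admissible l e m) (c : ℕ → ℤ) (h1 : m ≤ r) :
    threshold l m c r = 0 := by
  obtain ⟨hl, hm, he⟩ := h
  simp only [threshold]
  split_ifs <;> omega

/-- The reflection takes block `k` of runner `r < m` to block `-1 - k` of runner `m - 1 - r`, which
has the opposite charge. A runner `m`, present if `e = m + 1`, has charge zero and is reflected to
itself about its bead in block `-1`. -/
theorem selfDual_fullAbacus {l : ℕ} {e m : ℤ} (h : Admissible l e m) (c : ℕ → ℤ) :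
    SelfDual (m - 1 - e) (fullAbacus l e m c) := by
  intro y
  obtain ⟨k, r, h0, h1, rfl⟩ := exists_coord h.pos y
  rw [mem_fullAbacus h0 h1]
  have hm := h.2.1
  have he := h.2.2
  have hl := h.1
  by_cases hr : r < m
  · have e1 : m - 1 - e - (k * e + r) = (-1 - k) * e + (m - 1 - r) := by ring
    rw [e1, mem_fullAbacus (by omega) (by omega), threshold_reflect h c h0 hr]
    have h2 : ¬ 2 * (k * e + r) = m - 1 - e := by
      intro h2
      have h3 : k * e + r = -1 * e + m := by omega
      rw [coord_inj h0 h1 (by omega) (by omega)] at h3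
      omega
    omega
  · have e1 : m - 1 - e - (k * e + r) = (-2 - k) * e + r := by
      have : r = m := by omega
      subst this
      have : e = r + 1 := by omega
      subst this
      ring
    rw [e1, mem_fullAbacus h0 h1, threshold_of_ge h c (by omega)]
    have h2 : 2 * (k * e + r) = m - 1 - e ↔ k = -1 := by
      have h3 : m - 1 - e = 2 * (-1 * e + r) := by omega
      rw [h3, mul_right_inj' two_ne_zero, coord_inj h0 h1 h0 h1]
      simp
    rw [h2]
    omega

theorem sub_mem_fullAbacus {l : ℕ} {e m : ℤ} (he : 0 < e) {c : ℕ → ℤ} {x : ℤ}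
    (hx : x ∈ fullAbacus l e m c) : x - e ∈ fullAbacus l e m c := by
  obtain ⟨k, r, h0, h1, rfl⟩ := exists_coord he x
  rw [show k * e + r - e = (k - 1) * e + r by ring]
  rw [mem_fullAbacus h0 h1] at hx ⊢
  omega

theorem fullAbacus_bounded {l : ℕ} {e m : ℤ} (he : 0 < e) (c : ℕ → ℤ) :
    ∃ N : ℕ, (∀ x ∈ fullAbacus l e m c, x < N) ∧ ∀ x : ℤ, x < -N → x ∈ fullAbacus l e m c := by
  set C := ∑ j ∈ Finset.range l, |c j| with hC
  have hC0 : 0 ≤ C := Finset.sum_nonneg fun _ _ => abs_nonneg _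
  have hc : ∀ j < l, |c j| ≤ C := fun j hj =>
    Finset.single_le_sum (f := fun j => |c j|) (fun _ _ => abs_nonneg _) (Finset.mem_range.2 hj)
  have hT : ∀ r, 0 ≤ r → |threshold l m c r| ≤ C := by
    intro r hr
    rw [threshold]
    split_ifs with h1 h2
    · exact hc _ (by omega)
    · rw [abs_neg]
      exact hc _ (by omega)
    · simpa using hC0
  refine ⟨(C * e).toNat, ?_, ?_⟩
  · intro x hx
    obtain ⟨k, r, h0, h1, rfl⟩ := exists_coord he x
    rw [mem_fullAbacus h0 h1] at hx
    have h2 := le_abs_self (threshold l m c r)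
    have h3 := hT r h0
    have h4 : (k + 1) * e ≤ C * e := mul_le_mul_of_nonneg_right (by omega) he.le
    rw [add_mul, one_mul] at h4
    omega
  · intro x hx
    obtain ⟨k, r, h0, h1, rfl⟩ := exists_coord he x
    rw [mem_fullAbacus h0 h1]
    have h2 := neg_abs_le (threshold l m c r)
    have h3 := hT r h0
    by_contra! h5
    have h4 : (-C) * e ≤ k * e := mul_le_mul_of_nonneg_right (by omega) he.le
    have h6 : 0 ≤ C * e := mul_nonneg hC0 he.le
    rw [neg_mul] at h4
    omega

theorem fullAbacus_injOn {l : ℕ} {e m : ℤ} (h : Admissible l e m) {c c' : ℕ → ℤ}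
    (hc : Supported l c) (hc' : Supported l c') (heq : fullAbacus l e m c = fullAbacus l e m c') :
    c = c' := by
  funext j
  rcases le_or_gt l j with hj | hj
  · rw [hc j hj, hc' j hj]
  have hT (c : ℕ → ℤ) : threshold l m c j = c j := by
    rw [threshold, if_pos (by exact_mod_cast hj), Int.toNat_natCast]
  obtain ⟨hl, hm, he⟩ := h
  have key (k : ℤ) : k < c j ↔ k < c' j := by
    rw [← hT c, ← hT c', ← mem_fullAbacus (e := e) (by omega) (by omega), heq,
      mem_fullAbacus (by omega) (by omega)]
  have h1 := key (c j)
  have h2 := key (c' j)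
  omega

/-- Self-dual cores are the full abaci. -/
theorem exists_eq_fullAbacus {l : ℕ} {e m : ℤ} (h : Admissible l e m) {D : Set ℤ} {N : ℕ}
    (h1 : ∀ x ∈ D, x < N) (h2 : ∀ x : ℤ, x < -N → x ∈ D) (hD : SelfDual (m - 1 - e) D)
    (hcore : ∀ x ∈ D, x - e ∈ D) : ∃ c, Supported l c ∧ D = fullAbacus l e m c := by
  have he := h.pos
  -- The core condition makes every runner closed downwards, and boundedness then makes it an
  -- initial segment.
  have hex : ∀ r : ℤ, ∃ t : ℤ, 0 ≤ r → r < e → ∀ k, k * e + r ∈ D ↔ k < t := by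
    intro r
    by_cases hr : 0 ≤ r ∧ r < e
    swap
    · exact ⟨0, fun h3 h4 => absurd ⟨h3, h4⟩ hr⟩
    have hb : ∀ z, z * e + r ∈ D → z ≤ N := by
      intro z hz
      have h3 := h1 _ hz
      by_contra! h4
      have h5 : (N : ℤ) * e ≤ z * e := mul_le_mul_of_nonneg_right h4.le he.le
      have h6 : (N : ℤ) * 1 ≤ N * e := mul_le_mul_of_nonneg_left (by omega) (by omega)
      omega
    have hn : ∃ z, z * e + r ∈ D := by
      refine ⟨-N - 2, h2 _ ?_⟩
      have h6 : (N : ℤ) * 1 ≤ N * e := mul_le_mul_of_nonneg_left (by omega) (by omega)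
      rw [sub_mul, neg_mul]
      omega
    obtain ⟨t, ht, ht'⟩ := Int.exists_greatest_of_bdd ⟨N, hb⟩ hn
    refine ⟨t + 1, fun _ _ k => ⟨fun hk => ?_, fun hk => ?_⟩⟩
    · have := ht' k hk
      omega
    · have hdown : ∀ n : ℕ, (t - n) * e + r ∈ D := by
        intro n
        induction n with
        | zero => simpa using ht
        | succ n ih =>
          have := hcore _ ih
          push_cast
          rwa [show (t - (n + 1)) * e + r = (t - n) * e + r - e by ring]
      have := hdown (t - k).toNat
      rwa [show t - ((t - k).toNat : ℤ) = k by omega] at this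
  choose t ht using hex
  obtain ⟨hl, hm, hem⟩ := id h
  have hrefl : ∀ r, 0 ≤ r → r < m → t (m - 1 - r) = -t r := by
    intro r h0 hr
    have key : ∀ k, k < t (m - 1 - r) ↔ k < -t r := by
      intro k
      rw [← ht (m - 1 - r) (by omega) (by omega) k, hD,
        show m - 1 - e - (k * e + (m - 1 - r)) = (-1 - k) * e + r by ring,
        ht r h0 (by omega)]
      have h3 : ¬ 2 * (k * e + (m - 1 - r)) = m - 1 - e := by
        intro h3
        have h4 : k * e + (m - 1 - r) = -1 * e + m := by omega
        rw [coord_inj (by omega) (by omega) (by omega) (by omega)] at h4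
        omega
      omega
    have h3 := key (-t r)
    have h4 := key (t (m - 1 - r))
    omega
  -- The fixed point of the reflection is a bead, so the charge is nonnegative. A bead in block `0`
  -- would, by duality, leave a gap in block `-2` of the same runner.
  have hlast : m < e → t m = 0 := by
    intro hme
    have hem' : e = m + 1 := by omega
    have h3 : -1 * e + m ∈ D := (hD _).2 (Or.inr (by omega))
    rw [ht m (by omega) hme] at h3
    have h4 : 0 * e + m ∉ D := by
      intro h4
      have h5 := (hD _).1 h4
      rw [show m - 1 - e - (0 * e + m) = -2 * e + m by rw [hem']; ring, ht m (by omega) hme] at h5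
      omega
    rw [ht m (by omega) hme] at h4
    omega
  refine ⟨fun j => if j < l then t j else 0, fun j hj => if_neg (by omega), ?_⟩
  ext x
  obtain ⟨k, r, h0, hr, rfl⟩ := exists_coord he x
  rw [mem_fullAbacus h0 hr, ht r h0 hr]
  suffices t r = threshold l m (fun j => if j < l then t j else 0) r by rw [this]
  rw [threshold]
  split_ifs with h3 h4 h5 h6
  · rw [Int.toNat_of_nonneg h0]
  · omega
  · rw [Int.toNat_of_nonneg (by omega), hrefl r h0 (by omega), neg_neg]
  · omega
  · by_cases hrm : r < m
    · have := hrefl r h0 hrm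
      rw [show m - 1 - r = r by omega] at this
      omega
    · rw [show r = m by omega]
      exact hlast (by omega)

/-- A self-dual set is recovered from its nonnegative part. -/
theorem SelfDual.inter_union_eq {s : ℤ} (hs : s = -1 ∨ s = -2) {D : Set ℤ} (h : SelfDual s D) :
    (D ∩ Set.Ici 0) ∪ {y | y < 0 ∧ s - y ∉ D ∩ Set.Ici 0} = D := by
  ext y
  simp only [Set.mem_union, Set.mem_inter_iff, Set.mem_Ici, Set.mem_ofPred_eq, not_and_or]
  have h1 := h y
  have h2 := h (s - y)
  by_cases hy : 0 ≤ y
  · simp [hy]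
  · have h3 : ¬ 0 ≤ s - y ↔ 2 * y = s := by omega
    rw [h3, h1]
    simp [hy, not_le.1 hy]

theorem double_inter {s : ℤ} {B : Set ℤ} (hB : B ⊆ Set.Ici 0) :
    (B ∪ {y | y < 0 ∧ s - y ∉ B}) ∩ Set.Ici 0 = B := by
  ext y
  simp only [Set.mem_inter_iff, Set.mem_union, Set.mem_ofPred_eq, Set.mem_Ici]
  have h1 : y ∈ B → 0 ≤ y := fun h => hB h
  constructor
  · rintro ⟨h | h, h2⟩
    · exact h
    · omega
  · exact fun h => ⟨Or.inl h, h1 h⟩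

/-! ### The number of beads at nonnegative positions -/

theorem even_sum_natAbs (l : ℕ) (c : ℕ → ℤ) :
    Even (∑ j ∈ Finset.range l, (c j).natAbs) ↔ Even (∑ j ∈ Finset.range l, c j) := by
  induction l with
  | zero => simp
  | succ n ih =>
    rw [Finset.sum_range_succ, Finset.sum_range_succ, Nat.even_add, Int.even_add, Int.natAbs_even]
    simp only [ih]

/-- Of two runners with charges `c j` and `-c j`, only the one with positive charge has beads at
nonnegative positions, namely `|c j|` of them. The number `|c j|` has the parity of `c j`. -/
theorem even_ncard_fullAbacus {l : ℕ} {e m : ℤ} (h : Admissible l e m) (c : ℕ → ℤ) :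
    Even (fullAbacus l e m c ∩ Set.Ici 0).ncard ↔ Even (∑ j ∈ Finset.range l, c j) := by
  have he := h.pos
  obtain ⟨hl, hm, hem⟩ := h
  set f : (_ : ℕ) × ℕ → ℤ := fun p => p.2 * e + if 0 < c p.1 then (p.1 : ℤ) else m - 1 - p.1 with hf
  set S : Finset ((_ : ℕ) × ℕ) := (Finset.range l).sigma fun j => Finset.range (c j).natAbs with hS
  have hres : ∀ j : ℕ, j < l → 0 ≤ (if 0 < c j then (j : ℤ) else m - 1 - j) ∧
      (if 0 < c j then (j : ℤ) else m - 1 - j) < e := by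
    intro j hj
    split_ifs <;> omega
  have himage : fullAbacus l e m c ∩ Set.Ici 0 = f '' S := by
    ext x
    obtain ⟨k, r, h0, h1, rfl⟩ := exists_coord he x
    rw [Set.mem_inter_iff, mem_fullAbacus h0 h1, Set.mem_Ici, coord_nonneg h0 h1, Set.mem_image]
    constructor
    · rintro ⟨hk, hk0⟩
      rw [threshold] at hk
      split_ifs at hk with h2 h3
      · refine ⟨⟨r.toNat, k.toNat⟩, ?_, ?_⟩
        · rw [Finset.mem_coe, hS, Finset.mem_sigma, Finset.mem_range, Finset.mem_range]
          constructor <;> dsimp only <;> omega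
        · simp only [hf]
          rw [if_pos (by omega), Int.toNat_of_nonneg h0, Int.toNat_of_nonneg hk0]
      · refine ⟨⟨(m - 1 - r).toNat, k.toNat⟩, ?_, ?_⟩
        · rw [Finset.mem_coe, hS, Finset.mem_sigma, Finset.mem_range, Finset.mem_range]
          constructor <;> dsimp only <;> omega
        · simp only [hf]
          rw [if_neg (by omega), Int.toNat_of_nonneg hk0, Int.toNat_of_nonneg (by omega)]
          ring
      · omega
    · rintro ⟨⟨j, n⟩, hp, hpe⟩
      rw [Finset.mem_coe, hS, Finset.mem_sigma, Finset.mem_range, Finset.mem_range] at hp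
      obtain ⟨hj, hn⟩ := hp
      dsimp only at hj hn
      simp only [hf] at hpe
      obtain ⟨h2, h3⟩ := hres j hj
      rw [coord_inj h2 h3 h0 h1] at hpe
      obtain ⟨rfl, rfl⟩ := hpe
      refine ⟨?_, by omega⟩
      rw [threshold]
      by_cases hc : 0 < c j
      · rw [if_pos hc, if_pos (by omega), Int.toNat_natCast]
        omega
      · rw [if_neg hc, if_neg (by omega), if_pos (by omega),
          show (m - 1 - (m - 1 - (j : ℤ))).toNat = j by omega]
        omega
  have hinj : Set.InjOn f S := by
    rintro ⟨j, n⟩ hp ⟨j', n'⟩ hp' heq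
    rw [Finset.mem_coe, hS, Finset.mem_sigma, Finset.mem_range, Finset.mem_range] at hp hp'
    obtain ⟨hj, hn⟩ := hp
    obtain ⟨hj', hn'⟩ := hp'
    dsimp only at hj hn hj' hn'
    simp only [hf] at heq
    rw [coord_inj (hres j hj).1 (hres j hj).2 (hres j' hj').1 (hres j' hj').2] at heq
    obtain ⟨h2, h3⟩ := heq
    have h4 : j = j' := by
      split_ifs at h3 <;> omega
    subst h4
    have h5 : n = n' := by omega
    rw [h5]
  rw [himage, Set.InjOn.ncard_image hinj, Set.ncard_coe_finset, hS, Finset.card_sigma]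
  simp only [Finset.card_range]
  exact even_sum_natAbs l c

/-! ### Bead moves in coordinates -/

/-- The Dynkin diagram branches at the vertices `l - 2, l - 1, l`. -/
def RightFork : ClassicalAffineType → Bool
  | D1 => true
  | _ => false

/-- The position of the runner `-a` in its block is `blockLen X l - a`. -/
def blockLen (X : ClassicalAffineType) (l : ℕ) : ℤ :=
  2 * l + (if RightShort X then 1 else 0)

theorem one_le_of_minRank_le (hl : X.minRank ≤ l) : 1 ≤ l := by
  cases X <;> simp only [minRank] at hl <;> omega

theorem admissible (hl : X.minRank ≤ l) : Admissible l (numRunners X l) (blockLen X l) := by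
  refine ⟨one_le_of_minRank_le hl, ?_⟩
  cases X <;> simp [numRunners, blockLen, LeftShort, RightShort]

theorem numRunners_of_leftFork (h : LeftFork X = true) : (numRunners X l : ℤ) = blockLen X l := by
  cases X <;> simp [LeftFork, numRunners, blockLen, LeftShort, RightShort] at h ⊢

theorem blockLen_of_rightFork (h : RightFork X = true) :
    blockLen X l = 2 * l ∧ (numRunners X l : ℤ) = 2 * l := by
  cases X <;> simp [RightFork, numRunners, blockLen, LeftShort, RightShort] at h ⊢

theorem three_le_of_leftFork (hl : X.minRank ≤ l) (h : LeftFork X = true) : 3 ≤ l := by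
  cases X <;> simp [LeftFork, minRank] at h hl <;> omega

theorem four_le_of_rightFork (hl : X.minRank ≤ l) (h : RightFork X = true) : 4 ≤ l := by
  cases X <;> simp [RightFork, minRank] at h hl; omega

theorem eq_posPlus_iff (hl : X.minRank ≤ l) {k r κ a : ℤ} (h0 : 0 ≤ r) (h1 : r < numRunners X l)
    (ha : 1 ≤ a) (hal : a ≤ l) :
    k * numRunners X l + r = posPlus X l κ a ↔ k = κ ∧ r = a - 1 := by
  have h := admissible hl
  have hm := h.2.1
  have he := h.2.2
  exact coord_inj h0 h1 (by omega) (by omega)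

theorem eq_posMinus_iff (hl : X.minRank ≤ l) {k r κ a : ℤ} (h0 : 0 ≤ r)
    (h1 : r < numRunners X l) (ha : 1 ≤ a) (hal : a ≤ l) :
    k * numRunners X l + r = posMinus X l κ a ↔ k = κ ∧ r = blockLen X l - a := by
  have h := admissible hl
  have hm := h.2.1
  have he := h.2.2
  exact coord_inj (r' := blockLen X l - a) h0 h1 (by omega) (by omega)

theorem fMove_middle (hl : X.minRank ≤ l) {k r k' r' : ℤ} (h0 : 0 ≤ r)
    (h1 : r < numRunners X l) (h0' : 0 ≤ r') (h1' : r' < numRunners X l) {i : ℕ}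
    (hi : 0 < i) (hil : i < l) :
    FMove X l i (k * numRunners X l + r) (k' * numRunners X l + r') ↔
      k' = k ∧ (r = i - 1 ∧ r' = i ∨ r = blockLen X l - i - 1 ∧ r' = blockLen X l - i) := by
  have e (κ : ℤ) : ((k * numRunners X l + r = posPlus X l κ i ∧
      k' * numRunners X l + r' = posPlus X l κ (i + 1)) ∨
      (k * numRunners X l + r = posMinus X l κ (i + 1) ∧
      k' * numRunners X l + r' = posMinus X l κ i)) ↔
      (k = κ ∧ r = i - 1) ∧ (k' = κ ∧ r' = i + 1 - 1) ∨
      (k = κ ∧ r = blockLen X l - (i + 1)) ∧ (k' = κ ∧ r' = blockLen X l - i) := by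
    rw [eq_posPlus_iff hl h0 h1 (by omega) (by omega), eq_posPlus_iff hl h0' h1' (by omega)
      (by omega), eq_posMinus_iff hl h0 h1 (by omega) (by omega), eq_posMinus_iff hl h0' h1'
      (by omega) (by omega)]
  simp only [FMove, hi, hil, hi.ne', hil.ne, true_and, false_and, or_false, e]
  constructor
  · rintro ⟨κ, h⟩
    omega
  · intro h
    exact ⟨k, by omega⟩

theorem fMove_zero (hl : X.minRank ≤ l) {k r k' r' : ℤ} (h0 : 0 ≤ r)
    (h1 : r < numRunners X l) (h0' : 0 ≤ r') (h1' : r' < numRunners X l) (hX : LeftFork X = false) :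
    FMove X l 0 (k * numRunners X l + r) (k' * numRunners X l + r') ↔
      k' = k + 1 ∧ r = blockLen X l - 1 ∧ r' = 0 := by
  have hl0 : l ≠ 0 := by
    have := one_le_of_minRank_le hl
    omega
  have e (κ : ℤ) : (k * numRunners X l + r = posMinus X l (κ - 1) 1 ∧
      k' * numRunners X l + r' = posPlus X l κ 1) ↔
      (k = κ - 1 ∧ r = blockLen X l - 1) ∧ (k' = κ ∧ r' = 1 - 1) := by
    rw [eq_posPlus_iff hl h0' h1' (by omega) (by omega), eq_posMinus_iff hl h0 h1 (by omega)
      (by omega)]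
  have h : FMove X l 0 (k * numRunners X l + r) (k' * numRunners X l + r') ↔
      ∃ κ : ℤ, k * numRunners X l + r = posMinus X l (κ - 1) 1 ∧
        k' * numRunners X l + r' = posPlus X l κ 1 := by
    cases X <;> simp [LeftFork] at hX <;> simp [FMove, hl0.symm]
  rw [h, exists_congr e]
  constructor
  · rintro ⟨κ, h⟩
    omega
  · intro h
    exact ⟨k', by omega⟩

theorem fMove_zero_fork (hl : X.minRank ≤ l) {k r k' r' : ℤ} (h0 : 0 ≤ r)
    (h1 : r < numRunners X l) (h0' : 0 ≤ r') (h1' : r' < numRunners X l) (hX : LeftFork X = true) :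
    FMove X l 0 (k * numRunners X l + r) (k' * numRunners X l + r') ↔
      k' = k + 1 ∧ (r = blockLen X l - 1 ∧ r' = 1 ∨ r = blockLen X l - 2 ∧ r' = 0) := by
  have hl3 := three_le_of_leftFork hl hX
  have hl0 : l ≠ 0 := by omega
  have e (κ : ℤ) : ((k * numRunners X l + r = posMinus X l (κ - 1) 1 ∧
      k' * numRunners X l + r' = posPlus X l κ 2) ∨
      (k * numRunners X l + r = posMinus X l (κ - 1) 2 ∧
      k' * numRunners X l + r' = posPlus X l κ 1)) ↔
      (k = κ - 1 ∧ r = blockLen X l - 1) ∧ (k' = κ ∧ r' = 2 - 1) ∨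
      (k = κ - 1 ∧ r = blockLen X l - 2) ∧ (k' = κ ∧ r' = 1 - 1) := by
    rw [eq_posPlus_iff hl h0' h1' (by omega) (by omega), eq_posMinus_iff hl h0 h1 (by omega)
      (by omega), eq_posPlus_iff hl h0' h1' (by omega) (by omega), eq_posMinus_iff hl h0 h1
      (by omega) (by omega)]
  have h : FMove X l 0 (k * numRunners X l + r) (k' * numRunners X l + r') ↔
      ∃ κ : ℤ, (k * numRunners X l + r = posMinus X l (κ - 1) 1 ∧
        k' * numRunners X l + r' = posPlus X l κ 2) ∨
        (k * numRunners X l + r = posMinus X l (κ - 1) 2 ∧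
        k' * numRunners X l + r' = posPlus X l κ 1) := by
    cases X <;> simp [LeftFork] at hX <;> simp [FMove, hl0.symm]
  rw [h, exists_congr e]
  constructor
  · rintro ⟨κ, h⟩
    omega
  · intro h
    exact ⟨k', by omega⟩

theorem fMove_last (hl : X.minRank ≤ l) {k r k' r' : ℤ} (h0 : 0 ≤ r)
    (h1 : r < numRunners X l) (h0' : 0 ≤ r') (h1' : r' < numRunners X l)
    (hX : RightFork X = false) :
    FMove X l l (k * numRunners X l + r) (k' * numRunners X l + r') ↔
      k' = k ∧ r = l - 1 ∧ r' = blockLen X l - l := by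
  have hl0 : l ≠ 0 := by
    have := one_le_of_minRank_le hl
    omega
  have e (κ : ℤ) : (k * numRunners X l + r = posPlus X l κ l ∧
      k' * numRunners X l + r' = posMinus X l κ l) ↔
      (k = κ ∧ r = l - 1) ∧ (k' = κ ∧ r' = blockLen X l - l) := by
    rw [eq_posPlus_iff hl h0 h1 (by omega) (by omega), eq_posMinus_iff hl h0' h1' (by omega)
      (by omega)]
  have h : FMove X l l (k * numRunners X l + r) (k' * numRunners X l + r') ↔
      ∃ κ : ℤ, k * numRunners X l + r = posPlus X l κ l ∧
        k' * numRunners X l + r' = posMinus X l κ l := by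
    cases X <;> simp [RightFork] at hX <;> simp [FMove, hl0]
  rw [h, exists_congr e]
  constructor
  · rintro ⟨κ, h⟩
    omega
  · intro h
    exact ⟨k', by omega⟩

theorem fMove_last_fork (hl : X.minRank ≤ l) {k r k' r' : ℤ} (h0 : 0 ≤ r)
    (h1 : r < numRunners X l) (h0' : 0 ≤ r') (h1' : r' < numRunners X l)
    (hX : RightFork X = true) :
    FMove X l l (k * numRunners X l + r) (k' * numRunners X l + r') ↔
      k' = k ∧ (r = l - 1 ∧ r' = blockLen X l - l + 1 ∨ r = l - 2 ∧ r' = blockLen X l - l) := by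
  have hl4 := four_le_of_rightFork hl hX
  have hl0 : l ≠ 0 := by omega
  have e (κ : ℤ) : ((k * numRunners X l + r = posPlus X l κ l ∧
      k' * numRunners X l + r' = posMinus X l κ (l - 1)) ∨
      (k * numRunners X l + r = posPlus X l κ (l - 1) ∧
      k' * numRunners X l + r' = posMinus X l κ l)) ↔
      (k = κ ∧ r = l - 1) ∧ (k' = κ ∧ r' = blockLen X l - (l - 1)) ∨
      (k = κ ∧ r = l - 1 - 1) ∧ (k' = κ ∧ r' = blockLen X l - l) := by
    rw [eq_posPlus_iff hl h0 h1 (by omega) (by omega), eq_posMinus_iff hl h0' h1' (by omega)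
      (by omega), eq_posPlus_iff hl h0 h1 (by omega) (by omega), eq_posMinus_iff hl h0' h1'
      (by omega) (by omega)]
  have h : FMove X l l (k * numRunners X l + r) (k' * numRunners X l + r') ↔
      ∃ κ : ℤ, (k * numRunners X l + r = posPlus X l κ l ∧
        k' * numRunners X l + r' = posMinus X l κ (l - 1)) ∨
        (k * numRunners X l + r = posPlus X l κ (l - 1) ∧
        k' * numRunners X l + r' = posMinus X l κ l) := by
    cases X <;> simp [RightFork] at hX
    simp [FMove, hl0]
  rw [h, exists_congr e]
  constructor
  · rintro ⟨κ, h⟩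
    omega
  · intro h
    exact ⟨k', by omega⟩

/-! ### The action of the generators on charges -/

/-- The effect of `σ_i` on the charges of the runners. -/
def chargeRefl (X : ClassicalAffineType) (l i : ℕ) (c : ℕ → ℤ) (j : ℕ) : ℤ :=
  if i = 0 then
    if LeftFork X then (if j = 0 then 1 - c 1 else if j = 1 then 1 - c 0 else c j)
    else if j = 0 then 1 - c 0 else c j
  else if i = l then
    if RightFork X then
      (if j = l - 1 then -c (l - 2) else if j = l - 2 then -c (l - 1) else c j)
    else if j = l - 1 then -c (l - 1) else c j
  else if j = i - 1 then c i else if j = i then c (i - 1) else c j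

/-- The runner linked by `f_i` to the runner `r` (`r` itself if there is none), and the change
of the block. -/
def partner (X : ClassicalAffineType) (l i : ℕ) (r : ℤ) : ℤ × ℤ :=
  if i = 0 then
    if LeftFork X then
      if r = 0 then (blockLen X l - 2, -1) else if r = 1 then (blockLen X l - 1, -1)
      else if r = blockLen X l - 1 then (1, 1) else if r = blockLen X l - 2 then (0, 1)
      else (r, 0)
    else if r = 0 then (blockLen X l - 1, -1) else if r = blockLen X l - 1 then (0, 1)
    else (r, 0)
  else if i = l then
    if RightFork X then
      if r = l - 1 then (l + 1, 0) else if r = l - 2 then (l, 0) else if r = l then (l - 2, 0)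
      else if r = l + 1 then (l - 1, 0) else (r, 0)
    else if r = l - 1 then (blockLen X l - l, 0) else if r = blockLen X l - l then (l - 1, 0)
    else (r, 0)
  else if r = i - 1 then (i, 0) else if r = i then (i - 1, 0)
  else if r = blockLen X l - i - 1 then (blockLen X l - i, 0)
  else if r = blockLen X l - i then (blockLen X l - i - 1, 0) else (r, 0)

theorem partner_mem (hl : X.minRank ≤ l) {i : ℕ} (hi : i ≤ l) {r : ℤ} (h0 : 0 ≤ r)
    (h1 : r < numRunners X l) :
    0 ≤ (partner X l i r).1 ∧ (partner X l i r).1 < numRunners X l := by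
  obtain ⟨hl1, hm, he⟩ := admissible hl
  have hf := three_le_of_leftFork hl
  have hrf := four_le_of_rightFork hl
  have hd := blockLen_of_rightFork (X := X) (l := l)
  rw [partner]
  split_ifs <;> constructor <;> dsimp only <;> grind

/-- Bead moves act on whole runners: every position of runner `r` is linked to at most one other,
with a runner and a shift of block that do not depend on the block. This is what makes `σ_i` act on
charges. -/
theorem linked_iff (hl : X.minRank ≤ l) {i : ℕ} (hi : i ≤ l) {k r k' r' : ℤ} (h0 : 0 ≤ r)
    (h1 : r < numRunners X l) (h0' : 0 ≤ r') (h1' : r' < numRunners X l) :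
    (FMove X l i (k' * numRunners X l + r') (k * numRunners X l + r) ∨
      FMove X l i (k * numRunners X l + r) (k' * numRunners X l + r')) ↔
      (partner X l i r).1 ≠ r ∧ r' = (partner X l i r).1 ∧ k' = k + (partner X l i r).2 := by
  obtain ⟨hl1, hm, he⟩ := admissible hl
  rcases Nat.eq_zero_or_pos i with rfl | hi0
  · cases hX : LeftFork X
    · rw [fMove_zero hl h0 h1 h0' h1' hX, fMove_zero hl h0' h1' h0 h1 hX]
      simp only [partner, hX, if_true, if_false, Bool.false_eq_true]
      split_ifs <;> dsimp only <;> omega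
    · have hl3 := three_le_of_leftFork hl hX
      rw [fMove_zero_fork hl h0 h1 h0' h1' hX, fMove_zero_fork hl h0' h1' h0 h1 hX]
      simp only [partner, hX, if_true]
      split_ifs <;> dsimp only <;> omega
  rcases hi.lt_or_eq with hil | rfl
  · rw [fMove_middle hl h0 h1 h0' h1' hi0 hil, fMove_middle hl h0' h1' h0 h1 hi0 hil]
    simp only [partner, hi0.ne', hil.ne, if_false]
    split_ifs <;> dsimp only <;> omega
  · cases hX : RightFork X
    · rw [fMove_last hl h0 h1 h0' h1' hX, fMove_last hl h0' h1' h0 h1 hX]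
      simp only [partner, hX, hi0.ne', if_true, if_false, Bool.false_eq_true]
      split_ifs <;> dsimp only <;> omega
    · have hl4 := four_le_of_rightFork hl hX
      have hd := blockLen_of_rightFork (l := i) hX
      rw [fMove_last_fork hl h0 h1 h0' h1' hX, fMove_last_fork hl h0' h1' h0 h1 hX]
      simp only [partner, hX, hi0.ne', if_true, if_false]
      split_ifs <;> dsimp only <;> omega

/-- Exchanging the contents of linked runners exchanges their thresholds, corrected by the shift of
block. `chargeRefl` records the outcome on the runners `0, …, l - 1`, and the check on the other
runners shows that opposite charges are preserved. -/
theorem threshold_chargeRefl (hl : X.minRank ≤ l) {i : ℕ} (hi : i ≤ l) (c : ℕ → ℤ) {r : ℤ}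
    (h0 : 0 ≤ r) (h1 : r < numRunners X l) :
    threshold l (blockLen X l) (chargeRefl X l i c) r =
      threshold l (blockLen X l) c (partner X l i r).1 - (partner X l i r).2 := by
  obtain ⟨hl1, hm, he⟩ := admissible hl
  have hf := three_le_of_leftFork hl
  have hrf := four_le_of_rightFork hl
  have hd := blockLen_of_rightFork (X := X) (l := l)
  have hdl := numRunners_of_leftFork (X := X) (l := l)
  rcases Nat.eq_zero_or_pos i with rfl | hi0
  · cases hX : LeftFork X
    · simp only [partner, hX, if_true, if_false, Bool.false_eq_true]
      split_ifs
      all_goals simp only [threshold, chargeRefl, hX, if_true, if_false, Bool.false_eq_true]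
      all_goals grind
    · have hl3 := hf hX
      simp only [partner, hX, if_true]
      split_ifs
      all_goals simp only [threshold, chargeRefl, hX, if_true]
      all_goals grind
  rcases hi.lt_or_eq with hil | rfl
  · simp only [partner, hi0.ne', hil.ne, if_false]
    split_ifs
    all_goals simp only [threshold, chargeRefl, hi0.ne', hil.ne, if_false]
    all_goals grind
  · cases hX : RightFork X
    · simp only [partner, hX, hi0.ne', if_true, if_false, Bool.false_eq_true]
      split_ifs
      all_goals simp only [threshold, chargeRefl, hX, hi0.ne', if_true, if_false,
        Bool.false_eq_true]
      all_goals grind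
    · have hl4 := hrf hX
      simp only [partner, hX, hi0.ne', if_true, if_false]
      split_ifs
      all_goals simp only [threshold, chargeRefl, hX, hi0.ne', if_true, if_false]
      all_goals grind

theorem partner_snd (hl : X.minRank ≤ l) (i : ℕ) {r : ℤ} (h : (partner X l i r).1 = r) :
    (partner X l i r).2 = 0 := by
  obtain ⟨hl1, hm, he⟩ := admissible hl
  have hf := three_le_of_leftFork hl
  rw [partner] at h ⊢
  split_ifs at h ⊢ <;> first | rfl | (dsimp only at h; grind)

theorem partner_snd_of_ne {i : ℕ} (hi : i ≠ 0) (r : ℤ) : (partner X l i r).2 = 0 := by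
  simp only [partner, hi, if_false]
  split_ifs <;> rfl

/-- The half or whole abacus with prescribed charges. -/
def abacus (X : ClassicalAffineType) (l : ℕ) (c : ℕ → ℤ) : Set ℤ :=
  fullAbacus l (numRunners X l) (blockLen X l) c ∩ positions X

theorem positions_eq (h : X ≠ C1) : positions X = Set.Ici 0 := by
  cases X <;> first | rfl | exact absurd rfl h

theorem bornPositions_subset : bornPositions X ⊆ positions X := by
  cases X <;> simp [bornPositions, positions, Set.insert_subset_iff]

theorem mem_abacus_of_mem {c : ℕ → ℤ} {k r : ℤ} (h0 : 0 ≤ r) (h1 : r < numRunners X l)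
    (h : k * numRunners X l + r ∈ positions X) :
    k * numRunners X l + r ∈ abacus X l c ↔ k < threshold l (blockLen X l) c r := by
  rw [abacus, Set.mem_inter_iff, mem_fullAbacus h0 h1, and_iff_left h]

open Classical in
/-- The bead moves of `f_i`, without the special `f_0`-actions, on an abacus with prescribed
charges. -/
theorem exists_linked_iff (hl : X.minRank ≤ l) {i : ℕ} (hi : i ≤ l) (c : ℕ → ℤ) {k r : ℤ}
    (h0 : 0 ≤ r) (h1 : r < numRunners X l) (hy : k * numRunners X l + r ∈ positions X) :
    ((∃ x ∈ abacus X l c, Linked X l i x (k * numRunners X l + r)) ∨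
      (k * numRunners X l + r ∈ abacus X l c ∧
        ¬ ∃ x, Linked X l i x (k * numRunners X l + r))) ↔
    if (k + (partner X l i r).2) * numRunners X l + (partner X l i r).1 ∈ positions X then
      k * numRunners X l + r ∈ abacus X l (chargeRefl X l i c)
    else k * numRunners X l + r ∈ abacus X l c := by
  obtain ⟨hp0, hp1⟩ := partner_mem hl hi h0 h1
  have key (x : ℤ) : Linked X l i x (k * numRunners X l + r) ↔
      x ∈ positions X ∧ (partner X l i r).1 ≠ r ∧
        x = (k + (partner X l i r).2) * numRunners X l + (partner X l i r).1 := by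
    obtain ⟨k', r', h0', h1', rfl⟩ := exists_coord (admissible hl).pos x
    rw [Linked, linked_iff hl hi h0 h1 h0' h1', coord_inj h0' h1' hp0 hp1,
      and_iff_right hy, and_comm (a := k' = _)]
  have h2 : (∃ x ∈ abacus X l c, Linked X l i x (k * numRunners X l + r)) ↔
      (partner X l i r).1 ≠ r ∧
        (k + (partner X l i r).2) * numRunners X l + (partner X l i r).1 ∈ abacus X l c := by
    simp only [key]
    constructor
    · rintro ⟨x, hx, -, h3, rfl⟩
      exact ⟨h3, hx⟩
    · rintro ⟨h3, h4⟩
      exact ⟨_, h4, h4.2, h3, rfl⟩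
  have h3 : (∃ x, Linked X l i x (k * numRunners X l + r)) ↔
      (partner X l i r).1 ≠ r ∧
        (k + (partner X l i r).2) * numRunners X l + (partner X l i r).1 ∈ positions X := by
    simp only [key]
    constructor
    · rintro ⟨x, hx, h3, rfl⟩
      exact ⟨h3, hx⟩
    · rintro ⟨h3, h4⟩
      exact ⟨_, h4, h3, rfl⟩
  rw [h2, h3, mem_abacus_of_mem h0 h1 hy, mem_abacus_of_mem h0 h1 hy,
    threshold_chargeRefl hl hi c h0 h1]
  -- If the linked position lies in the abacus, the two contents are exchanged; the case of a runner
  -- that is its own partner is vacuous. If it lies outside, nothing moves.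
  split_ifs with h4
  · rw [mem_abacus_of_mem hp0 hp1 h4]
    by_cases h5 : (partner X l i r).1 = r
    · simp only [h5, partner_snd hl i h5, ne_eq, not_true, false_and, not_false_iff, and_true,
        false_or, sub_zero]
    · simp only [h5, h4, ne_eq, not_true, not_false_iff, and_self, true_and, and_false, or_false]
      omega
  · have h5 : (k + (partner X l i r).2) * numRunners X l + (partner X l i r).1 ∉ abacus X l c :=
      fun h => h4 h.2
    simp only [h4, h5, and_false, false_or, not_false_iff, and_true]

theorem threshold_natCast {c : ℕ → ℤ} {j : ℕ} (hj : j < l) (m : ℤ) :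
    threshold l m c j = c j := by
  rw [threshold, if_pos (by exact_mod_cast hj), Int.toNat_natCast]

theorem natCast_mem_abacus (hl : X.minRank ≤ l) (c : ℕ → ℤ) {j : ℕ} (hj : j < l) :
    (j : ℤ) ∈ abacus X l c ↔ 0 < c j := by
  have h := admissible hl
  have hm := h.2.1
  have he := h.2.2
  have h1 : (0 : ℤ) * numRunners X l + j = j := by ring
  have h2 : (j : ℤ) ∈ positions X := by
    cases X <;> simp [positions]
  have h3 := mem_abacus_of_mem (X := X) (l := l) (c := c) (k := 0) (r := j) (by omega) (by omega)
    (by rwa [h1])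
  rwa [h1, threshold_natCast hj] at h3

/-- The generators act on the charges by affine reflections. -/
theorem sigma_abacus (hl : X.minRank ≤ l) {i : ℕ} (hi : i ≤ l) (c : ℕ → ℤ) :
    sigma X l i (abacus X l c) = abacus X l (chargeRefl X l i c) := by
  have hadm := admissible hl
  obtain ⟨hl1, hm, he⟩ := id hadm
  ext y
  by_cases hy : y ∈ positions X
  swap
  · have h1 : y ∉ abacus X l (chargeRefl X l i c) := fun h => hy h.2
    have h2 : y ∉ abacus X l c := fun h => hy h.2
    have h3 : ∀ x, ¬ Linked X l i x y := fun x h => hy h.2.1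
    have h4 : y ∉ bornPositions X := fun h => hy (bornPositions_subset h)
    simp only [sigma]
    split_ifs <;> simp [h1, h2, h3, h4]
  obtain ⟨k, r, h0, hr, rfl⟩ := exists_coord hadm.pos y
  have key := exists_linked_iff hl hi c h0 hr hy
  by_cases hi0 : i = 0
  swap
  · rw [partner_snd_of_ne hi0, if_pos] at key
    · simp only [sigma, hi0, if_false]
      exact key
    · by_cases hC : X = C1
      · subst hC
        exact Set.mem_univ _
      · rw [positions_eq hC, Set.mem_Ici] at hy ⊢
        obtain ⟨hp0, hp1⟩ := partner_mem hl hi h0 hr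
        rw [coord_nonneg hp0 hp1]
        rw [coord_nonneg h0 hr] at hy
        omega
  subst hi0
  by_cases hC : X = C1
  · subst hC
    rw [if_pos (show _ ∈ positions C1 from Set.mem_univ _)] at key
    simp only [sigma, bornPositions, Set.empty_disjoint, if_true, Set.union_empty]
    exact key
  obtain ⟨hp0, hp1⟩ := partner_mem hl hi h0 hr
  rw [positions_eq hC, Set.mem_Ici, coord_nonneg hp0 hp1] at key
  have hk : 0 ≤ k := by
    rw [positions_eq hC, Set.mem_Ici, coord_nonneg h0 hr] at hy
    exact hy
  cases hX : LeftFork X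
  · have hborn : bornPositions X = {0} := by
      cases X <;> simp [LeftFork] at hX <;> first | rfl | exact absurd rfl hC
    have h00 : (0 : ℤ) ∈ abacus X l c ↔ 0 < c 0 := by
      exact_mod_cast natCast_mem_abacus hl c (j := 0) (by omega)
    -- Position `0` is the only one whose partner has a negative block. There the special action
    -- simply toggles the bead, in agreement with `0 < c 0` turning into `0 < 1 - c 0`.
    by_cases hb : k = 0 ∧ r = 0
    · obtain ⟨rfl, rfl⟩ := hb
      have h01 : (0 : ℤ) ∈ abacus X l (chargeRefl X l 0 c) ↔ 0 < 1 - c 0 := by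
        have := natCast_mem_abacus hl (chargeRefl X l 0 c) (j := 0) (by omega)
        simpa [chargeRefl, hX] using this
      rw [zero_mul, zero_add, h01]
      simp only [sigma, hborn, if_true, Set.disjoint_singleton_left, Set.singleton_subset_iff, h00]
      split_ifs with h2
      · simp; omega
      · simp; omega
    · have hn : k * numRunners X l + r ∉ bornPositions X := by
        rw [hborn, Set.mem_singleton_iff]
        intro h
        have h2 : k * numRunners X l + r = 0 * numRunners X l + 0 := by rw [h]; ring
        exact hb ((coord_inj h0 hr le_rfl hadm.pos).1 h2)
      have hpos : 0 ≤ k + (partner X l 0 r).2 := by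
        simp only [partner, hX, if_true, if_false, Bool.false_eq_true]
        split_ifs <;> dsimp only <;> omega
      rw [if_pos hpos] at key
      rw [← key]
      simp only [sigma, if_true]
      split_ifs <;> simp [hn]
  · have hl3 := three_le_of_leftFork hl hX
    have hborn : bornPositions X = {0, 1} := by
      cases X <;> simp [LeftFork] at hX <;> rfl
    have h00 : (0 : ℤ) ∈ abacus X l c ↔ 0 < c 0 := by
      exact_mod_cast natCast_mem_abacus hl c (j := 0) (by omega)
    have h10 : (1 : ℤ) ∈ abacus X l c ↔ 0 < c 1 := by
      exact_mod_cast natCast_mem_abacus hl c (j := 1) (by omega)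
    -- The positions `0` and `1` are those whose partners fall off the half abacus.
    by_cases hb : k = 0 ∧ (r = 0 ∨ r = 1)
    · have hpos : ¬ 0 ≤ k + (partner X l 0 r).2 := by
        simp only [partner, hX, if_true]
        split_ifs <;> dsimp only <;> omega
      rw [if_neg hpos] at key
      have hdis : Disjoint ({0, 1} : Set ℤ) (abacus X l c) ↔ ¬ 0 < c 0 ∧ ¬ 0 < c 1 := by
        rw [Set.disjoint_insert_left, Set.disjoint_singleton_left, h00, h10]
      have hsub : ({0, 1} : Set ℤ) ⊆ abacus X l c ↔ 0 < c 0 ∧ 0 < c 1 := by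
        rw [Set.insert_subset_iff, Set.singleton_subset_iff, h00, h10]
      have h01 : (0 : ℤ) ∈ abacus X l (chargeRefl X l 0 c) ↔ 0 < 1 - c 1 := by
        have := natCast_mem_abacus hl (chargeRefl X l 0 c) (j := 0) (by omega)
        simpa [chargeRefl, hX] using this
      have h11 : (1 : ℤ) ∈ abacus X l (chargeRefl X l 0 c) ↔ 0 < 1 - c 0 := by
        have := natCast_mem_abacus hl (chargeRefl X l 0 c) (j := 1) (by omega)
        simpa [chargeRefl, hX] using this
      obtain ⟨rfl, hr01⟩ := hb
      simp only [sigma, hborn, if_true, hdis, hsub]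
      rw [zero_mul, zero_add] at *
      have hmem : r ∈ ({0, 1} : Set ℤ) := hr01
      split_ifs with h2 h3
      · rw [Set.mem_union, or_iff_right_of_imp (fun _ => hmem), iff_true_left hmem]
        rcases hr01 with rfl | rfl
        · rw [h01]; omega
        · rw [h11]; omega
      · rw [Set.mem_sdiff, eq_true hmem, not_true, and_false, false_iff]
        rcases hr01 with rfl | rfl
        · rw [h01]; omega
        · rw [h11]; omega
      -- Exactly one of the two positions is occupied, and no special action applies. For integers,
      -- `0 < 1 - c 1` means that `1` is empty, that is, that `0` is occupied, so the new charges
      -- give the same beads here.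
      · refine key.trans ?_
        rcases hr01 with rfl | rfl
        · rw [h01, h00]; omega
        · rw [h11, h10]; omega
    · have hn : k * numRunners X l + r ∉ bornPositions X := by
        rw [hborn, Set.mem_insert_iff, Set.mem_singleton_iff]
        rintro (h | h)
        · have h2 : k * numRunners X l + r = 0 * numRunners X l + 0 := by rw [h]; ring
          have := (coord_inj h0 hr le_rfl hadm.pos).1 h2
          omega
        · have h2 : k * numRunners X l + r = 0 * numRunners X l + 1 := by rw [h]; ring
          have := (coord_inj h0 hr (by omega) (by omega)).1 h2
          omega
      have hpos : 0 ≤ k + (partner X l 0 r).2 := by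
        simp only [partner, hX, if_true]
        split_ifs <;> dsimp only <;> omega
      rw [if_pos hpos] at key
      rw [← key]
      simp only [sigma, if_true]
      split_ifs <;> simp [hn]

/-! ### Weights of abaci -/

/-- The number of addable minus the number of removable `i`-nodes, as a function of the
charges. -/
def kappa (X : ClassicalAffineType) (l : ℕ) (c : ℕ → ℤ) (i : ℕ) : ℤ :=
  if i = 0 then (if LeftFork X then 1 - c 0 - c 1 else 1 - 2 * c 0)
  else if i = l then
    match X with
    | A2odd | A2even => c (l - 1)
    | B1 | C1 | D2 => 2 * c (l - 1)
    | D1 => c (l - 2) + c (l - 1)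
  else
    match X with
    | C1 => 2 * (c (i - 1) - c i)
    | A2odd | A2even | B1 | D1 | D2 => c (i - 1) - c i

theorem cartan_eq (i j : Fin (l + 1)) : cartan X l i j =
    if (i : ℕ) = j then 2
    else if (i : ℕ) < j then (cartanPair l i j X).1 else (cartanPair l j i X).2 := by
  simp only [cartan, Fin.ext_iff, Fin.lt_def]

/-- The integers `kappa` transform like the numbers `⟨v, α_j^∨⟩` under `v ↦ v - ⟨v, α_i^∨⟩α_i`. This
identifies the reflections of charges with those of `𝔥^*`. -/
theorem kappa_chargeRefl (hl : X.minRank ≤ l) (c : ℕ → ℤ) (i j : Fin (l + 1)) :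
    kappa X l (chargeRefl X l i c) j = kappa X l c j - kappa X l c i * cartan X l j i := by
  rw [cartan_eq]
  obtain ⟨i, hi⟩ := i
  obtain ⟨j, hj⟩ := j
  dsimp only
  cases X
  all_goals simp only [minRank] at hl
  all_goals simp only [kappa, chargeRefl, cartanPair, LeftFork, RightFork, if_true, if_false,
    Bool.false_eq_true]
  all_goals grind (splits := 25)

theorem sum_eq_of_agree_off_one {c c' : ℕ → ℤ} (g : ℕ → ℤ → ℤ) {p : ℕ} (hp : p < l)
    (h : ∀ j, j ≠ p → c' j = c j) :
    ∑ j ∈ Finset.range l, g j (c' j) =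
      ∑ j ∈ Finset.range l, g j (c j) + (g p (c' p) - g p (c p)) := by
  rw [← sub_eq_iff_eq_add', ← Finset.sum_sub_distrib]
  refine Finset.sum_eq_single p (fun j _ hj => ?_) fun h => absurd (Finset.mem_range.2 hp) h
  rw [h j hj, sub_self]

theorem sum_eq_of_agree_off_two {c c' : ℕ → ℤ} (g : ℕ → ℤ → ℤ) {p q : ℕ} (hp : p < l)
    (hq : q < l) (hpq : p ≠ q) (h : ∀ j, j ≠ p → j ≠ q → c' j = c j) :
    ∑ j ∈ Finset.range l, g j (c' j) = ∑ j ∈ Finset.range l, g j (c j) +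
      (g p (c' p) - g p (c p)) + (g q (c' q) - g q (c q)) := by
  rw [add_assoc, ← sub_eq_iff_eq_add', ← Finset.sum_sub_distrib,
    ← Finset.sum_pair hpq (f := fun j => g j (c' j) - g j (c j))]
  refine (Finset.sum_subset ?_ fun j _ hj => ?_).symm
  · intro j hj
    rw [Finset.mem_insert, Finset.mem_singleton] at hj
    rw [Finset.mem_range]
    omega
  · rw [Finset.mem_insert, Finset.mem_singleton, not_or] at hj
    rw [h j hj.1 hj.2, sub_self]

/-- The change of a sum over the runners under the action of a generator on the charges. -/
theorem sum_chargeRefl (hl : X.minRank ≤ l) {i : ℕ} (hi : i ≤ l) (c : ℕ → ℤ) (g : ℕ → ℤ → ℤ) :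
    ∑ j ∈ Finset.range l, g j (chargeRefl X l i c j) = ∑ j ∈ Finset.range l, g j (c j) +
      if i = 0 then
        if LeftFork X then (g 0 (1 - c 1) - g 0 (c 0)) + (g 1 (1 - c 0) - g 1 (c 1))
        else g 0 (1 - c 0) - g 0 (c 0)
      else if i = l then
        if RightFork X then (g (l - 1) (-c (l - 2)) - g (l - 1) (c (l - 1))) +
          (g (l - 2) (-c (l - 1)) - g (l - 2) (c (l - 2)))
        else g (l - 1) (-c (l - 1)) - g (l - 1) (c (l - 1))
      else (g (i - 1) (c i) - g (i - 1) (c (i - 1))) + (g i (c (i - 1)) - g i (c i)) := by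
  have hl1 := one_le_of_minRank_le hl
  have hf := three_le_of_leftFork hl
  have hrf := four_le_of_rightFork hl
  split_ifs with h0 h1 h2 h3
  · have := hf h1
    rw [sum_eq_of_agree_off_two g (show 0 < l by omega) (show 1 < l by omega) (by omega)
      (c := c) (fun j hj0 hj1 => by simp [chargeRefl, h0, h1, hj0, hj1]), add_assoc]
    simp [chargeRefl, h0, h1]
  · rw [sum_eq_of_agree_off_one g (show 0 < l by omega)
      (c := c) (fun j hj0 => by simp [chargeRefl, h0, h1, hj0])]
    simp [chargeRefl, h0, h1]
  · have := hrf h3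
    subst h2
    rw [sum_eq_of_agree_off_two g (show i - 1 < i by omega) (show i - 2 < i by omega) (by omega)
      (c := c) (fun j hj0 hj1 => by simp [chargeRefl, h0, h3, hj0, hj1]), add_assoc]
    have h4 : i - 2 ≠ i - 1 := by omega
    simp [chargeRefl, h0, h3, h4]
  · subst h2
    rw [sum_eq_of_agree_off_one g (show i - 1 < i by omega)
      (c := c) (fun j hj0 => by simp [chargeRefl, h0, h3, hj0])]
    simp [chargeRefl, h0, h3]
  · rw [sum_eq_of_agree_off_two g (show i - 1 < l by omega) (show i < l by omega) (by omega)
      (c := c) (fun j hj0 hj1 => by simp [chargeRefl, h0, h2, hj0, hj1]), add_assoc]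
    have h4 : i ≠ i - 1 := by omega
    simp [chargeRefl, h0, h2, h4]

/-- The weight of the abacus with charges `c`. -/
noncomputable def weight (X : ClassicalAffineType) (l : ℕ) (c : ℕ → ℤ) : DualCartan l :=
  (fun i => (kappa X l c i : ℂ),
    -((if LeftFork X then 1 / 2 else 1) * ((∑ j ∈ Finset.range l, c j ^ 2 : ℤ) : ℂ)))

/-- In the last coordinate only `σ_0` changes the sum of squares, by `kappa X l c 0`, or by twice
that if the diagram branches at `0`; the factor `1 / 2` in `weight` compensates. -/
theorem weight_chargeRefl (hl : X.minRank ≤ l) (c : ℕ → ℤ) (i : Fin (l + 1)) :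
    weight X l (chargeRefl X l i c) = (gen X l i).1 (weight X l c) := by
  rw [gen_apply]
  refine Prod.ext (funext fun j => ?_) ?_
  · simp only [weight, kappa_chargeRefl hl, Prod.fst_sub, Prod.smul_fst, Pi.sub_apply,
      Pi.smul_apply, simpleRoot_fst, smul_eq_mul]
    push_cast
    ring
  · have h := sum_chargeRefl hl (Nat.lt_succ_iff.1 i.2) c fun _ x => x ^ 2
    simp only [weight, Prod.snd_sub, Prod.smul_snd, simpleRoot, smul_eq_mul, h]
    by_cases hi : i = 0
    · subst hi
      cases hX : LeftFork X
      · simp [kappa, hX]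
        ring
      · simp [kappa, hX]
        ring
    · have hi' : (i : ℕ) ≠ 0 := fun h => hi (Fin.ext h)
      simp only [hi, hi', if_false]
      split_ifs <;> push_cast <;> ring

theorem supported_chargeRefl (hl : X.minRank ≤ l) {i : ℕ} (hi : i ≤ l) {c : ℕ → ℤ}
    (hc : Supported l c) : Supported l (chargeRefl X l i c) := by
  intro j hj
  have hl1 := one_le_of_minRank_le hl
  have hf := three_le_of_leftFork hl
  have hrf := four_le_of_rightFork hl
  have := hc j hj
  simp only [chargeRefl]
  split_ifs <;> grind

/-- The values of `kappa` at `0 < i < l` determine the differences of consecutive charges. The value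
at `0` adds `c 0`, or `c 0 + c 1`, which together with `c 0 - c 1` again gives `c 0`. -/
theorem weight_injOn (hl : X.minRank ≤ l) {c c' : ℕ → ℤ} (hc : Supported l c)
    (hc' : Supported l c') (h : weight X l c = weight X l c') : c = c' := by
  have hl1 := one_le_of_minRank_le hl
  have hk : ∀ i, i ≤ l → kappa X l c i = kappa X l c' i := by
    intro i hi
    have h1 := congrFun (congrArg Prod.fst h) ⟨i, by omega⟩
    have h2 : (kappa X l c i : ℂ) = kappa X l c' i := h1
    exact_mod_cast h2
  have step : ∀ i, 0 < i → i < l → c (i - 1) - c i = c' (i - 1) - c' i := by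
    intro i hi0 hi
    have h1 := hk i hi.le
    simp only [kappa, hi0.ne', hi.ne, if_false] at h1
    cases X <;> dsimp only at h1 <;> omega
  have zero : c 0 = c' 0 := by
    have h0 := hk 0 (Nat.zero_le _)
    cases hX : LeftFork X
    · simp only [kappa, hX, if_true, if_false, Bool.false_eq_true] at h0
      omega
    · have hl3 := three_le_of_leftFork hl hX
      simp only [kappa, hX, if_true] at h0
      have := step 1 (by omega) (by omega)
      simp only [Nat.sub_self] at this
      omega
  funext j
  induction j with
  | zero => exact zero
  | succ j ih =>
    rcases lt_or_ge (j + 1) l with hj | hj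
    · have := step (j + 1) (by omega) hj
      rw [Nat.add_sub_cancel] at this
      omega
    · rw [hc _ hj, hc' _ hj]

theorem weight_zero (hl : X.minRank ≤ l) : weight X l 0 = fundamentalWeight l := by
  refine Prod.ext (funext fun j => ?_) ?_
  · by_cases hj : j = 0
    · subst hj
      simp [weight, fundamentalWeight, kappa]
    · have hj' : (j : ℕ) ≠ 0 := fun h => hj (Fin.ext h)
      have : kappa X l 0 j = 0 := by
        simp only [kappa, hj', if_false]
        cases X <;> simp
      simp [weight, fundamentalWeight, this, hj]
  · simp [weight, fundamentalWeight]

/-! ### The orbit of the empty abacus -/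

/-- The charges of the `0`-core abaci. -/
def IsCoreCharge (X : ClassicalAffineType) (l : ℕ) (c : ℕ → ℤ) : Prop :=
  Supported l c ∧ (LeftFork X = true → Even (∑ j ∈ Finset.range l, c j))

theorem isCoreCharge_chargeRefl (hl : X.minRank ≤ l) {i : ℕ} (hi : i ≤ l) {c : ℕ → ℤ}
    (hc : IsCoreCharge X l c) : IsCoreCharge X l (chargeRefl X l i c) := by
  refine ⟨supported_chargeRefl hl hi hc.1, fun hX => ?_⟩
  have h := hc.2 hX
  rw [sum_chargeRefl hl hi c fun _ x => x, Int.even_add]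
  simp only [h, hX, true_iff, if_true]
  split_ifs
  · exact ⟨1 - c 0 - c 1, by ring⟩
  · exact ⟨-c (l - 2) - c (l - 1), by ring⟩
  · exact ⟨-c (l - 1), by ring⟩
  · exact ⟨0, by ring⟩

theorem chargeRefl_chargeRefl (hl : X.minRank ≤ l) (i : ℕ) (c : ℕ → ℤ) :
    chargeRefl X l i (chargeRefl X l i c) = c := by
  have hl1 := one_le_of_minRank_le hl
  have hf := three_le_of_leftFork hl
  have hrf := four_le_of_rightFork hl
  funext j
  simp only [chargeRefl]
  split_ifs <;> grind

theorem eq_zero_of_kappa_nonneg (hl : X.minRank ≤ l) {c : ℕ → ℤ} (hc : IsCoreCharge X l c)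
    (h : ∀ i ≤ l, 0 ≤ kappa X l c i) : c = 0 := by
  have hl1 := one_le_of_minRank_le hl
  have step : ∀ i, 0 < i → i < l → c i ≤ c (i - 1) := by
    intro i hi0 hi
    have h1 := h i hi.le
    simp only [kappa, hi0.ne', hi.ne, if_false] at h1
    cases X <;> dsimp only at h1 <;> omega
  have anti : ∀ k j, j + k < l → c (j + k) ≤ c j := by
    intro k
    induction k with
    | zero => exact fun j _ => le_rfl
    | succ k ih =>
      intro j hj
      have h1 := ih j (by omega)
      have h2 := step (j + (k + 1)) (by omega) hj
      rw [show j + (k + 1) - 1 = j + k by omega] at h2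
      omega
  have anti' : ∀ j k, j ≤ k → k < l → c k ≤ c j := by
    intro j k hjk hk
    have := anti (k - j) j (by omega)
    rwa [show j + (k - j) = k by omega] at this
  have h0 := h 0 (Nat.zero_le _)
  have hlast := h l le_rfl
  have hfork : LeftFork X = true → 3 ≤ l ∧ c 1 ≤ 0 := by
    intro hX
    have hl3 := three_le_of_leftFork hl hX
    simp only [kappa, hX, if_true] at h0
    have := anti' 0 1 (by omega) (by omega)
    omega
  have hnonneg : 0 ≤ c (l - 1) := by
    simp only [kappa, if_true] at hlast
    cases X
    case D1 =>
      obtain ⟨hl3, h1⟩ := hfork rfl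
      have hl4 := four_le_of_rightFork hl rfl
      have h2 := anti' 1 (l - 2) (by omega) (by omega)
      dsimp only at hlast
      omega
    all_goals
      dsimp only at hlast
      omega
  funext j
  rw [Pi.zero_apply]
  rcases le_or_gt l j with hj | hj
  · exact hc.1 j hj
  have hj0 := anti' j (l - 1) (by omega) (by omega)
  cases hX : LeftFork X
  · simp only [kappa, hX, if_true, if_false, Bool.false_eq_true] at h0
    have := anti' 0 j (by omega) hj
    omega
  · obtain ⟨hl3, h1⟩ := hfork hX
    have hzero : ∀ k, 1 ≤ k → k < l → c k = 0 := by
      intro k hk hkl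
      have := anti' 1 k hk hkl
      have := anti' k (l - 1) (by omega) (by omega)
      omega
    rcases Nat.eq_zero_or_pos j with rfl | hjpos
    · have hsum := hc.2 hX
      rw [Finset.sum_eq_single_of_mem 0 (Finset.mem_range.2 hj) fun k hk hk0 =>
        hzero k (by omega) (Finset.mem_range.1 hk)] at hsum
      simp only [kappa, hX, if_true] at h0
      rw [hzero 1 le_rfl (by omega)] at h0
      obtain ⟨a, ha⟩ := hsum
      omega
    · exact hzero j hjpos hj

/-- A nonnegative function on charges that decreases along reflections at negative walls. -/
def energy (l : ℕ) (c : ℕ → ℤ) : ℤ :=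
  ∑ j ∈ Finset.range l, ((l + 1) * c j ^ 2 - (l - j) * c j)

theorem energy_nonneg (l : ℕ) (c : ℕ → ℤ) : 0 ≤ energy l c := by
  refine Finset.sum_nonneg fun j hj => ?_
  rw [Finset.mem_range] at hj
  have hj' : (j : ℤ) < l := by exact_mod_cast hj
  have hl0 : (0 : ℤ) ≤ l := by positivity
  have h1 : (0 : ℤ) ≤ (l + 1) * c j ^ 2 := by positivity
  rcases le_or_gt (c j) 0 with h | h
  · have h2 : (l - j : ℤ) * c j ≤ 0 := mul_nonpos_of_nonneg_of_nonpos (by omega) h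
    omega
  · have h2 : (l - j : ℤ) * c j ≤ (l + 1) * c j := mul_le_mul_of_nonneg_right (by omega) h.le
    have h3 : (l + 1 : ℤ) * c j ≤ (l + 1) * c j ^ 2 :=
      mul_le_mul_of_nonneg_left (by nlinarith) (by omega)
    omega

/-- Up to a constant, `energy` is `l + 1` times the squared distance from `c` to the point with
coordinates `(l - j) / (2(l + 1))`. This point is interior to the alcove, as its coordinates
decrease strictly and lie strictly between `0` and `1/2`. Reflecting in a wall that separates `c`
from it brings `c` closer. -/
theorem energy_chargeRefl_lt (hl : X.minRank ≤ l) {i : ℕ} (hi : i ≤ l) {c : ℕ → ℤ}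
    (h : kappa X l c i < 0) : energy l (chargeRefl X l i c) < energy l c := by
  have hl1 := one_le_of_minRank_le hl
  have hrf := four_le_of_rightFork hl
  rw [energy, energy,
    sum_chargeRefl hl hi c fun j x => ((l : ℤ) + 1) * x ^ 2 - (l - j) * x, add_lt_iff_neg_left]
  split_ifs with h0 h1 h2 h3
  · simp only [kappa, h0, h1, if_true] at h
    refine lt_of_eq_of_lt (b := 3 * (1 - c 0 - c 1)) (by push_cast; ring) (by omega)
  · simp only [kappa, h0, h1, if_true, if_false, Bool.false_eq_true] at h
    refine lt_of_eq_of_lt (b := 1 - 2 * c 0) (by push_cast; ring) h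
  · have h4 := hrf h3
    have h5 : X = D1 := by
      cases X <;> simp [RightFork] at h3 ⊢
    subst h5
    simp only [kappa, h2, if_true] at h
    refine lt_of_eq_of_lt (b := 3 * (c (l - 2) + c (l - 1))) ?_ (by omega)
    rw [Nat.cast_sub (by omega), Nat.cast_sub (by omega)]
    push_cast
    ring
  · have h4 : c (l - 1) < 0 := by
      simp only [kappa, h2, if_true] at h
      cases X
      case D1 => exact absurd rfl h3
      all_goals
        dsimp only at h
        omega
    refine lt_of_eq_of_lt (b := 2 * c (l - 1)) ?_ (by omega)
    rw [Nat.cast_sub (by omega)]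
    push_cast
    ring
  · have h4 : c (i - 1) - c i < 0 := by
      simp only [kappa, h0, h2, if_false] at h
      cases X <;> dsimp only at h <;> omega
    refine lt_of_eq_of_lt (b := c (i - 1) - c i) ?_ h4
    rw [Nat.cast_sub (by omega)]
    push_cast
    ring

theorem abacus_zero (hl : X.minRank ≤ l) : abacus X l 0 = emptyAbacus X := by
  have hadm := admissible hl
  ext x
  obtain ⟨k, r, h0, hr, rfl⟩ := exists_coord hadm.pos x
  have h1 : threshold l (blockLen X l) 0 r = 0 := by
    simp only [threshold, Pi.zero_apply, neg_zero, ite_self]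
  have h2 : k * (numRunners X l : ℤ) + r < 0 ↔ k < 0 := by
    rw [← not_le, ← not_le, coord_nonneg h0 hr]
  rw [abacus, Set.mem_inter_iff, mem_fullAbacus h0 hr, h1, ← h2]
  cases X
  case C1 => exact and_iff_left (Set.mem_univ _)
  all_goals
    simp only [emptyAbacus, positions, Set.mem_Ici, Set.mem_empty_iff_false, iff_false]
    omega

theorem sigma_mem_coreAbaci {B : Set ℤ} (hB : B ∈ coreAbaci X l) (i : Fin (l + 1)) :
    sigma X l i B ∈ coreAbaci X l := by
  obtain ⟨ws, rfl⟩ := hB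
  exact ⟨i :: ws, rfl⟩

theorem abacus_mem_coreAbaci (hl : X.minRank ≤ l) {c : ℕ → ℤ} (hc : IsCoreCharge X l c) :
    abacus X l c ∈ coreAbaci X l := by
  induction hn : (energy l c).toNat using Nat.strong_induction_on generalizing c with
  | _ n ih =>
    by_cases h : ∀ i ≤ l, 0 ≤ kappa X l c i
    · rw [eq_zero_of_kappa_nonneg hl hc h, abacus_zero hl]
      exact ⟨[], rfl⟩
    · push Not at h
      obtain ⟨i, hi, h1⟩ := h
      have h2 := energy_chargeRefl_lt hl hi h1
      have h3 := energy_nonneg l (chargeRefl X l i c)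
      have h4 := ih _ (by omega) (isCoreCharge_chargeRefl hl hi hc) rfl
      have h5 := sigma_mem_coreAbaci h4 ⟨i, by omega⟩
      rwa [sigma_abacus hl hi, chargeRefl_chargeRefl hl] at h5

theorem mem_coreAbaci_iff (hl : X.minRank ≤ l) (B : Set ℤ) :
    B ∈ coreAbaci X l ↔ ∃ c, IsCoreCharge X l c ∧ B = abacus X l c := by
  constructor
  · rintro ⟨ws, rfl⟩
    induction ws with
    | nil =>
      exact ⟨0, ⟨fun _ _ => rfl, fun _ => by simp⟩, (abacus_zero hl).symm⟩
    | cons i ws ih =>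
      obtain ⟨c, hc, h⟩ := ih
      have hi := Nat.lt_succ_iff.1 i.2
      exact ⟨chargeRefl X l i c, isCoreCharge_chargeRefl hl hi hc,
        (congrArg (sigma X l i) h).trans (sigma_abacus hl hi c)⟩
  · rintro ⟨c, hc, rfl⟩
    exact abacus_mem_coreAbaci hl hc

/-! ### Partitions of abaci -/

theorem reflection_center : blockLen X l - 1 - numRunners X l = -1 ∨
    blockLen X l - 1 - numRunners X l = -2 := by
  cases X <;> simp only [blockLen, numRunners, LeftShort, RightShort, if_true, if_false,
    Bool.false_eq_true] <;> omega

theorem associated_eq_double (h : X ≠ C1) (B : Set ℤ) : associated X B =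
    B ∪ {y | y < 0 ∧ blockLen X l - 1 - numRunners X l - y ∉ B} := by
  have key (s : ℤ) (hs : blockLen X l - 1 - numRunners X l = s) :
      B ∪ {y | y < 0 ∧ blockLen X l - 1 - numRunners X l - y ∉ B} =
        B ∪ {y | y < 0 ∧ s - y ∉ B} := by rw [hs]
  cases X
  case C1 => exact absurd rfl h
  case A2even | D2 =>
    rw [key (-2) (by simp [blockLen, numRunners, LeftShort, RightShort]; ring)]
    rfl
  all_goals
    rw [key (-1) (by simp [blockLen, numRunners, LeftShort, RightShort])]
    rfl

theorem associated_abacus (hl : X.minRank ≤ l) (c : ℕ → ℤ) :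
    associated X (abacus X l c) = fullAbacus l (numRunners X l) (blockLen X l) c := by
  by_cases h : X = C1
  · subst h
    exact Set.inter_univ _
  · rw [associated_eq_double (l := l) h, abacus, positions_eq h]
    exact (selfDual_fullAbacus (admissible hl) c).inter_union_eq reflection_center

theorem associated_inter_positions {B : Set ℤ} (hB : B ⊆ positions X) :
    associated X B ∩ positions X = B := by
  by_cases h : X = C1
  · subst h
    exact Set.inter_univ _
  · rw [associated_eq_double (l := 0) h, positions_eq h]
    rw [positions_eq h] at hB
    exact double_inter hB

theorem eq_abacus_iff (hl : X.minRank ≤ l) {B : Set ℤ} (hB : B ⊆ positions X) (c : ℕ → ℤ) :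
    B = abacus X l c ↔ associated X B = fullAbacus l (numRunners X l) (blockLen X l) c := by
  constructor
  · rintro rfl
    exact associated_abacus hl c
  · intro h
    rw [abacus, ← h, associated_inter_positions hB]

/-- One description for all types: the centre of duality is `-1/2` or `-1` according to the number
of runners outside the symmetric block, and diagonal nodes are counted as nonnegative beads. -/
theorem isCorePartition_iff (μ : YoungDiagram) : IsCorePartition X l μ ↔
    (SelfDual (blockLen X l - 1 - numRunners X l) (betaSet μ) ∧
      IsACore (numRunners X l) μ) ∧
      (LeftFork X = true → Even (betaSet μ ∩ Set.Ici 0).ncard) := by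
  have key (s : ℤ) (hs : blockLen X l - 1 - numRunners X l = s) :
      SelfDual (blockLen X l - 1 - numRunners X l) (betaSet μ) ↔ SelfDual s (betaSet μ) := by
    rw [hs]
  cases X
  case C1 =>
    rw [key (-1) (by simp [blockLen, numRunners, LeftShort, RightShort]), ← isSelfConjugate_iff]
    simp [IsCorePartition, LeftFork, numRunners, LeftShort, RightShort]
  case A2even | D2 =>
    rw [key (-2) (by simp [blockLen, numRunners, LeftShort, RightShort]; ring),
      ← isDoubledDistinct_iff]
    simp [IsCorePartition, LeftFork, numRunners, LeftShort, RightShort]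
  all_goals
    rw [key (-1) (by simp [blockLen, numRunners, LeftShort, RightShort]), ← isSelfConjugate_iff]
    simp only [IsCorePartition, IsEvenDiagram, card_diagonal, LeftFork, numRunners, LeftShort,
      RightShort, if_true, if_false, Bool.false_eq_true, forall_true_left, add_zero]
    tauto

theorem selfDual_core_iff {e : ℕ} {m : ℤ} (h : Admissible l e m) (μ : YoungDiagram) :
    SelfDual (m - 1 - e) (betaSet μ) ∧ IsACore e μ ↔
      ∃ c, Supported l c ∧ betaSet μ = fullAbacus l e m c := by
  constructor
  · rintro ⟨h1, h2⟩
    obtain ⟨N, h3, h4⟩ := exists_betaSet_bound μ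
    exact exists_eq_fullAbacus h h3 h4 h1 h2
  · rintro ⟨c, -, h1⟩
    rw [IsACore, h1]
    exact ⟨selfDual_fullAbacus h c, fun x hx => sub_mem_fullAbacus h.pos hx⟩

theorem isCorePartition_iff_exists (hl : X.minRank ≤ l) (μ : YoungDiagram) :
    IsCorePartition X l μ ↔ ∃ c, IsCoreCharge X l c ∧
      betaSet μ = fullAbacus l (numRunners X l) (blockLen X l) c := by
  have hadm := admissible hl
  rw [isCorePartition_iff, selfDual_core_iff hadm]
  constructor
  · rintro ⟨⟨c, hc, h1⟩, h2⟩
    rw [h1, even_ncard_fullAbacus hadm] at h2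
    exact ⟨c, ⟨hc, h2⟩, h1⟩
  · rintro ⟨c, ⟨hc, h2⟩, h1⟩
    rw [h1, even_ncard_fullAbacus hadm]
    exact ⟨⟨c, hc, rfl⟩, h2⟩

/-- A family of partitions described by charges is in bijection with the charges. -/
theorem exists_charge_equiv {e m : ℤ} (h : Admissible l e m) (hs : m - 1 - e = -1 ∨ m - 1 - e = -2)
    {C : (ℕ → ℤ) → Prop} {P : YoungDiagram → Prop} (hC : ∀ c, C c → Supported l c)
    (hP : ∀ μ, P μ ↔ ∃ c, C c ∧ betaSet μ = fullAbacus l e m c) :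
    ∃ Θ : {c // C c} ≃ {μ // P μ}, ∀ c, betaSet (Θ c) = fullAbacus l e m c := by
  have hex (c : {c // C c}) : ∃ μ : {μ // P μ}, betaSet μ = fullAbacus l e m c := by
    obtain ⟨N, h1, h2⟩ := fullAbacus_bounded (l := l) (m := m) h.pos c.1
    obtain ⟨μ, hμ⟩ := exists_betaSet_eq_of_selfDual hs h1 h2 (selfDual_fullAbacus h c.1)
    exact ⟨⟨μ, (hP μ).2 ⟨c, c.2, hμ⟩⟩, hμ⟩
  choose f hf using hex
  refine ⟨Equiv.ofBijective f ⟨fun c c' hcc => ?_, fun μ => ?_⟩, hf⟩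
  · refine Subtype.ext (fullAbacus_injOn h (hC _ c.2) (hC _ c'.2) ?_)
    rw [← hf, ← hf, hcc]
  · obtain ⟨c, hc, h1⟩ := (hP μ).1 μ.2
    refine ⟨⟨c, hc⟩, Subtype.ext (betaSet_injective ?_)⟩
    rw [hf, h1]

theorem threshold_sub {m : ℤ} (hm : 2 * (l : ℤ) ≤ m) (c : ℕ → ℤ) {a : ℕ} (ha : a < l) :
    threshold l m c (m - 1 - a) = -c a := by
  rw [threshold, if_neg (by omega), if_pos (by omega), show (m - 1 - (m - 1 - (a : ℤ))).toNat = a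
    by omega]

/-- The deleted runners carry charge zero, hence no beads at nonnegative positions. The others keep
their charges, so the same vector `c` describes the result on `2 * l` runners. -/
theorem deleteRunners_abacus (hl : X.minRank ≤ l) (hX : X ≠ C1) (c : ℕ → ℤ) :
    deleteRunners X l (abacus X l c) =
      fullAbacus l (2 * l : ℕ) (2 * l : ℕ) c ∩ Set.Ici 0 := by
  have hadm := admissible hl
  obtain ⟨hl1, hm, he⟩ := id hadm
  have mem {k r : ℤ} (h0 : 0 ≤ r) (h1 : r < numRunners X l) :
      k * numRunners X l + r ∈ abacus X l c ↔ k < threshold l (blockLen X l) c r ∧ 0 ≤ k := by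
    rw [abacus, Set.mem_inter_iff, mem_fullAbacus h0 h1, positions_eq hX, Set.mem_Ici,
      coord_nonneg h0 h1]
  have mem' {k r : ℤ} (h0 : 0 ≤ r) (h1 : r < (2 * l : ℕ)) :
      k * (2 * l : ℕ) + r ∈ fullAbacus l (2 * l : ℕ) (2 * l : ℕ) c ∩ Set.Ici 0 ↔
        k < threshold l (2 * l : ℕ) c r ∧ 0 ≤ k := by
    rw [Set.mem_inter_iff, mem_fullAbacus h0 h1, Set.mem_Ici, coord_nonneg h0 h1]
  have plus (k : ℤ) (a : ℕ) (ha : a < l) : posPlus X l k (a + 1) ∈ abacus X l c ↔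
      2 * l * k + (a + 1 - 1) ∈ fullAbacus l (2 * l : ℕ) (2 * l : ℕ) c ∩ Set.Ici 0 := by
    have e1 : posPlus X l k (a + 1) = k * numRunners X l + a := by
      rw [posPlus]; ring
    have e2 : 2 * l * k + ((a : ℤ) + 1 - 1) = k * (2 * l : ℕ) + a := by
      push_cast; ring
    rw [e1, e2, mem (by omega) (by omega), mem' (by omega) (by omega), threshold_natCast ha,
      threshold_natCast ha]
  have minus (k : ℤ) (a : ℕ) (ha : a < l) : posMinus X l k (a + 1) ∈ abacus X l c ↔
      2 * l * k + (2 * l - (a + 1)) ∈ fullAbacus l (2 * l : ℕ) (2 * l : ℕ) c ∩ Set.Ici 0 := by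
    have e1 : posMinus X l k (a + 1) = k * numRunners X l + (blockLen X l - 1 - a) := by
      rw [posMinus, blockLen]; ring
    have e2 : 2 * l * k + (2 * l - ((a : ℤ) + 1)) = k * (2 * l : ℕ) + ((2 * l : ℕ) - 1 - a) := by
      push_cast; ring
    rw [e1, e2, mem (by omega) (by omega), mem' (by omega) (by omega),
      threshold_sub (by omega) c ha, threshold_sub (by push_cast; omega) c ha]
  ext y
  constructor
  · rintro ⟨k, a, ha1, hal, ⟨h1, rfl⟩ | ⟨h1, rfl⟩⟩
    · obtain ⟨b, rfl⟩ : ∃ b : ℕ, a = b + 1 := ⟨(a - 1).toNat, by omega⟩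
      exact (plus k b (by omega)).1 h1
    · obtain ⟨b, rfl⟩ : ∃ b : ℕ, a = b + 1 := ⟨(a - 1).toNat, by omega⟩
      exact (minus k b (by omega)).1 h1
  · intro hy
    obtain ⟨k, r, h0, hr, rfl⟩ := exists_coord (e := (2 * l : ℕ)) (by omega) y
    by_cases hrl : r < l
    · obtain ⟨b, rfl⟩ : ∃ b : ℕ, r = b := ⟨r.toNat, by omega⟩
      have e2 : k * (2 * l : ℕ) + (b : ℤ) = 2 * l * k + ((b : ℤ) + 1 - 1) := by
        push_cast; ring
      rw [e2] at hy ⊢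
      exact ⟨k, b + 1, by omega, by omega, Or.inl ⟨(plus k b (by omega)).2 hy, rfl⟩⟩
    · obtain ⟨b, hb⟩ : ∃ b : ℕ, r = 2 * l - (b + 1) := ⟨(2 * l - 1 - r).toNat, by omega⟩
      have e2 : k * (2 * l : ℕ) + r = 2 * l * k + (2 * l - ((b : ℤ) + 1)) := by
        rw [hb]; push_cast; ring
      rw [e2] at hy ⊢
      exact ⟨k, b + 1, by omega, by omega, Or.inr ⟨(minus k b (by omega)).2 hy, rfl⟩⟩

theorem selfConjugateDouble_deleteRunners (hl : X.minRank ≤ l) (hX : X ≠ C1) (c : ℕ → ℤ) :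
    selfConjugateDouble (deleteRunners X l (abacus X l c)) =
      fullAbacus l (2 * l : ℕ) (2 * l : ℕ) c := by
  have hadm : Admissible l (2 * l : ℕ) (2 * l : ℕ) :=
    ⟨one_le_of_minRank_le hl, Or.inl (by push_cast; rfl), Or.inl rfl⟩
  have h := selfDual_fullAbacus hadm c
  rw [show ((2 * l : ℕ) : ℤ) - 1 - (2 * l : ℕ) = -1 by ring] at h
  rw [deleteRunners_abacus hl hX]
  exact h.inter_union_eq (Or.inl rfl)

/-! ### The action of the affine Weyl group -/

/-- The charges of the `0`-core abaci are in bijection with these abaci. -/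
theorem abacus_bijective (hl : X.minRank ≤ l) :
    Function.Bijective fun c : {c // IsCoreCharge X l c} =>
      (⟨abacus X l c, abacus_mem_coreAbaci hl c.2⟩ : coreAbaci X l) := by
  constructor
  · intro c c' h
    have h1 : abacus X l c = abacus X l c' := congrArg Subtype.val h
    refine Subtype.ext (fullAbacus_injOn (admissible hl) c.2.1 c'.2.1 ?_)
    rw [← associated_abacus hl, ← associated_abacus hl, h1]
  · rintro ⟨B, hB⟩
    obtain ⟨c, hc, rfl⟩ := (mem_coreAbaci_iff hl B).1 hB
    exact ⟨⟨c, hc⟩, rfl⟩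

/-- The `0`-core abacus with given charges. -/
noncomputable def chargeEquiv (hl : X.minRank ≤ l) :
    {c // IsCoreCharge X l c} ≃ coreAbaci X l :=
  Equiv.ofBijective _ (abacus_bijective hl)

theorem coe_chargeEquiv (hl : X.minRank ≤ l) (c : {c // IsCoreCharge X l c}) :
    (chargeEquiv hl c : Set ℤ) = abacus X l c := rfl

/-- The weight of a `0`-core abacus. -/
noncomputable def coreWeight (hl : X.minRank ≤ l) (B : coreAbaci X l) : DualCartan l :=
  weight X l ((chargeEquiv hl).symm B)

theorem coreWeight_injective (hl : X.minRank ≤ l) : Function.Injective (coreWeight hl) := by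
  intro B B' h
  refine (chargeEquiv hl).symm.injective (Subtype.ext (weight_injOn hl ?_ ?_ h))
  · exact ((chargeEquiv hl).symm B).2.1
  · exact ((chargeEquiv hl).symm B').2.1

theorem coreWeight_sigma (hl : X.minRank ≤ l) (B : coreAbaci X l) (i : Fin (l + 1)) :
    coreWeight hl ⟨sigma X l i B, sigma_mem_coreAbaci B.2 i⟩ =
      (gen X l i).1 (coreWeight hl B) := by
  have hi := Nat.lt_succ_iff.1 i.2
  obtain ⟨c, rfl⟩ := (chargeEquiv hl).surjective B
  have h : (⟨sigma X l i (chargeEquiv hl c), sigma_mem_coreAbaci (chargeEquiv hl c).2 i⟩ :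
      coreAbaci X l) =
        chargeEquiv hl ⟨chargeRefl X l i c, isCoreCharge_chargeRefl hl hi c.2⟩ :=
    Subtype.ext (sigma_abacus hl hi c)
  rw [h, coreWeight, coreWeight, Equiv.symm_apply_apply, Equiv.symm_apply_apply,
    weight_chargeRefl hl]

theorem coreWeight_emptyCore (hl : X.minRank ≤ l) :
    coreWeight hl (emptyCore X l) = fundamentalWeight l := by
  have h : emptyCore X l = chargeEquiv hl ⟨0, fun _ _ => rfl, fun _ => by simp⟩ :=
    Subtype.ext (abacus_zero hl).symm
  rw [h, coreWeight, Equiv.symm_apply_apply]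
  exact weight_zero hl

theorem exists_coreWeight_eq (hl : X.minRank ≤ l) (w : weylGroup X l) (B : coreAbaci X l) :
    ∃ B', coreWeight hl B' = w.1 (coreWeight hl B) := by
  obtain ⟨ws, rfl⟩ := exists_word w
  induction ws with
  | nil => exact ⟨B, rfl⟩
  | cons i ws ih =>
    obtain ⟨B', h⟩ := ih
    refine ⟨⟨sigma X l i B', sigma_mem_coreAbaci B'.2 i⟩, ?_⟩
    rw [coreWeight_sigma, h, List.map_cons, List.prod_cons, weyl_mul_apply]

/-- The weights of the cores form a `W`-stable set, and cores are determined by their weights. The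
action is therefore pulled back from `𝔥^*`, and its axioms follow from injectivity of `coreWeight`.
-/
theorem exists_action (hl : X.minRank ≤ l) :
    ∃ act : weylGroup X l →* Equiv.Perm (coreAbaci X l),
      ∀ w B, coreWeight hl (act w B) = w.1 (coreWeight hl B) := by
  choose f hf using exists_coreWeight_eq (X := X) (l := l) hl
  let F : weylGroup X l →* Function.End (coreAbaci X l) :=
    { toFun := f
      map_one' := funext fun B => coreWeight_injective hl (hf 1 B)
      map_mul' := fun w w' => funext fun B => coreWeight_injective hl (by
        rw [hf]
        exact (congrArg w.1 (hf w' B)).symm.trans (hf w _).symm) }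
  exact ⟨F.toHomPerm, hf⟩

/-- Among the elements sending `∅_X` to `B`, take a shortest one. For `i ≠ 0` the generator `σ_i`
fixes `∅_X`, so `wσ_i` also qualifies and is not shorter than `w`; by parity it is longer. -/
theorem exists_grassmannian_action_eq (hl : X.minRank ≤ l)
    {act : weylGroup X l →* Equiv.Perm (coreAbaci X l)}
    (hact : ∀ w B, coreWeight hl (act w B) = w.1 (coreWeight hl B)) (B : coreAbaci X l) :
    ∃ w : grassmannian X l, act w (emptyCore X l) = B := by
  have hfix (w : weylGroup X l) (i : Fin (l + 1)) (hi : i ≠ 0) :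
      act (w * gen X l i) (emptyCore X l) = act w (emptyCore X l) := by
    refine coreWeight_injective hl ?_
    rw [hact, hact, weyl_mul_apply, coreWeight_emptyCore, gen_apply_fundamentalWeight hi]
  have hex : ∃ w : weylGroup X l, act w (emptyCore X l) = B := by
    obtain ⟨B, ws, rfl⟩ := B
    refine ⟨(ws.map (gen X l)).prod, ?_⟩
    induction ws with
    | nil =>
      rw [List.map_nil, List.prod_nil, map_one]
      rfl
    | cons i ws ih =>
      rw [List.map_cons, List.prod_cons, map_mul, Equiv.Perm.mul_apply, ih]
      exact coreWeight_injective hl ((hact _ _).trans (coreWeight_sigma hl _ i).symm)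
  classical
  have hlen : ∃ n w, length X l w = n ∧ act w (emptyCore X l) = B :=
    hex.elim fun w hw => ⟨_, w, rfl, hw⟩
  obtain ⟨w, hw, hwB⟩ := Nat.find_spec hlen
  refine ⟨⟨w, fun i hi => ?_⟩, hwB⟩
  have h1 := Nat.find_min' hlen ⟨w * gen X l i, rfl, (hfix w i hi).trans hwB⟩
  have h2 := length_mul_gen_ne w i
  omega

end ClassicalAffineType

/-! ### Assembly: abaci, partitions and the affine Grassmannian -/

open ClassicalAffineType in
theorem mainTheorem12 (X : ClassicalAffineType) (l : ℕ) (hl : X.minRank ≤ l) :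
    -- a charge zero abacus is a core if and only if its (doubled) partition is a suitable core
    (∀ B : Set ℤ, B ⊆ X.positions → ∀ μ : YoungDiagram,
      ClassicalAffineType.betaSet μ = X.associated B →
        (B ∈ X.coreAbaci l ↔ X.IsCorePartition l μ)) ∧
    -- the affine Weyl group acts on the core abaci, each generator as prescribed
    ∃ act : X.weylGroup l →* Equiv.Perm (X.coreAbaci l),
      (∀ (i : Fin (l + 1)) (B : X.coreAbaci l),
        ((act (X.gen l i) B : X.coreAbaci l) : Set ℤ) = X.sigma l i B) ∧
      -- the affine Grassmannian is parameterized by the core abaci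
      Function.Bijective
        (fun w : X.grassmannian l => act (w : X.weylGroup l) (X.emptyCore l)) ∧
      -- by their (doubled) partitions
      (∃ Φ : X.grassmannian l ≃ {μ : YoungDiagram // X.IsCorePartition l μ},
        ∀ w : X.grassmannian l, ClassicalAffineType.betaSet (Φ w) =
          X.associated (act (w : X.weylGroup l) (X.emptyCore l) : X.coreAbaci l)) ∧
      -- and by self-conjugate cores
      (∃ Ψ : X.grassmannian l ≃ {μ : YoungDiagram // X.IsSelfConjugateCore l μ},
        ∀ w : X.grassmannian l, ClassicalAffineType.betaSet (Ψ w) =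
          X.selfConjugateBeta l
            (act (w : X.weylGroup l) (X.emptyCore l) : X.coreAbaci l)) := by
  refine ⟨fun B hB μ hμ => ?_, ?_⟩
  · rw [mem_coreAbaci_iff hl, isCorePartition_iff_exists hl, hμ]
    exact exists_congr fun c => and_congr_right fun _ => eq_abacus_iff hl hB c
  obtain ⟨act, hact⟩ := exists_action hl
  have hbij : Function.Bijective
      (fun w : X.grassmannian l => act (w : X.weylGroup l) (X.emptyCore l)) := by
    refine ⟨fun w w' h => Subtype.ext (grassmannian_eq_of_apply_eq hl w.2 w'.2 ?_),
      exists_grassmannian_action_eq hl hact⟩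
    rw [← coreWeight_emptyCore hl, ← hact, ← hact]
    exact congrArg _ h
  obtain ⟨Θ, hΘ⟩ := exists_charge_equiv (admissible hl) reflection_center
    (C := IsCoreCharge X l) (fun c hc => hc.1) (isCorePartition_iff_exists hl)
  have hΦ : ∃ Φ : X.grassmannian l ≃ {μ : YoungDiagram // X.IsCorePartition l μ},
      ∀ w : X.grassmannian l, betaSet (Φ w) =
        X.associated (act (w : X.weylGroup l) (X.emptyCore l) : X.coreAbaci l) := by
    refine ⟨(Equiv.ofBijective _ hbij).trans ((chargeEquiv hl).symm.trans Θ), fun w => ?_⟩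
    rw [Equiv.trans_apply, Equiv.trans_apply, hΘ, ← associated_abacus hl, ← coe_chargeEquiv hl,
      Equiv.apply_symm_apply]
    rfl
  refine ⟨act, fun i B => ?_, hbij, hΦ, ?_⟩
  · exact congrArg Subtype.val (coreWeight_injective hl
      ((hact _ _).trans (coreWeight_sigma hl B i).symm))
  have hadm : Admissible l (2 * l : ℕ) (2 * l : ℕ) :=
    ⟨one_le_of_minRank_le hl, Or.inl (by push_cast; rfl), Or.inl rfl⟩
  have hs : ((2 * l : ℕ) : ℤ) - 1 - (2 * l : ℕ) = -1 := by ring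
  have hsc (hX : LeftFork X = false) (μ : YoungDiagram) :
      IsSelfConjugate μ ∧ IsACore (2 * l) μ ↔ ∃ c, IsCoreCharge X l c ∧
        betaSet μ = fullAbacus l (2 * l : ℕ) (2 * l : ℕ) c := by
    have h := selfDual_core_iff hadm μ
    rw [hs, ← isSelfConjugate_iff] at h
    rw [h]
    simp [IsCoreCharge, hX]
  -- Without a fork at `0` the charges are arbitrary, so the vectors that parameterize the cores of
  -- type `X` parameterize the self-conjugate `2l`-cores as well. Passing from one to the other is
  -- deletion of runners.
  have hΨ (hX : LeftFork X = false) (hC : X ≠ C1) :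
      ∃ Ψ : X.grassmannian l ≃ {μ : YoungDiagram // IsSelfConjugate μ ∧ IsACore (2 * l) μ},
        ∀ w : X.grassmannian l, betaSet (Ψ w) = selfConjugateDouble (deleteRunners X l
          (act (w : X.weylGroup l) (X.emptyCore l) : X.coreAbaci l)) := by
    obtain ⟨Θ', hΘ'⟩ := exists_charge_equiv hadm (Or.inl hs)
      (C := IsCoreCharge X l) (fun c hc => hc.1) (hsc hX)
    refine ⟨(Equiv.ofBijective _ hbij).trans ((chargeEquiv hl).symm.trans Θ'), fun w => ?_⟩
    rw [Equiv.trans_apply, Equiv.trans_apply, hΘ', ← selfConjugateDouble_deleteRunners hl hC,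
      ← coe_chargeEquiv hl, Equiv.apply_symm_apply]
    rfl
  cases X
  case A2even | D2 => exact hΨ rfl (by simp)
  -- In the remaining types the two families of partitions and the two β-sets coincide by
  -- definition.
  all_goals exact hΦ
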